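/- Setting. Let $d\ge 1$ and let $\Lambda\subset\mathbb R^d$ be a finite set with $|x-y|\ge 1$ for all distinct $x,y\in\Lambda$ ($|\cdot|$ is the Euclidean norm). On the bosonic Fock space $\mathcal F(\ell^2(\Lambda))$, with creation and annihilation operators $a_x^*,a_x$ and number operators $n_x=a_x^*a_x$, consider $$H_\Lambda=\sum_{x,y\in\Lambda}J_{xy}\,a_x^*a_y+V,\qquad V=\Phi(\{n_x\}_{x\in\Lambda}),$$ where $J=(J_{xy})$ is a Hermitian $|\Lambda|\times|\Lambda|$ matrix and $\Phi$ is an arbitrary real-valued function. For $X\subset\Lambda$ let $N_X=\sum_{x\in X}n_x$; let $B_h=\{x\in\Lambda:|x|\le h\}$; for an initial state $\psi_0$ let $\psi_t=e^{-iH_\Lambda t}\psi_0$ and $\langle A\rangle_t=\langle\psi_t,A\psi_t\rangle$ (for $A=N_X$ in the sense of quadratic forms). Theorem. Let $d\ge1$, $\alpha>2d+1$, $C_J>0$, $\delta_0>0$ and $v>\kappa$ be given. There is a constant $C=C(\alpha,d,C_J,\kappa,v,\delta_0)>0$, independent of $\Lambda$, $J$, $\Phi$, $\lambda$, $R$, $r$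 and $\psi_0$, such that the following holds for all $\Lambda$, $J$ and $\Phi$ as above with $$|J_{xy}|\le C_J|x-y|^{-\alpha}\quad(x,y\in\Lambda,\ x\ne y),\qquad \sup_{x\in\Lambda}\sum_{y\in\Lambda}|J_{xy}|\,|x-y|\le\kappa .$$ For all $\lambda,R,r>0$ with $R-r>\max(\delta_0 r,1)$ and all initial states $\psi_0\in\mathcal D(N_\Lambda^{1/2})$ with $\langle N_X\rangle_0\le\lambda|X|$ for every $X\subset\Lambda$, $$\sup_{0\le t<(R-r)/v}\langle N_{B_r}\rangle_t\le\bigl(1+C(R-r)^{-1}\bigr)\langle N_{B_R}\rangle_0+C\lambda .$$ -/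

import Mathlib

open scoped ENNReal

noncomputable section

namespace BoseGas

/-- Euclidean `d`-space, in which the sites live. -/
abbrev Space (d : ℕ) : Type := EuclideanSpace ℝ (Fin d)

section FockSpace

variable {ι : Type} [DecidableEq ι]

/-- Occupation-number configurations over a finite set `ι` of sites. -/
abbrev Occ (ι : Type) : Type := ι → ℕ

/-- The bosonic Fock space over `ℓ²(ι)`, in its occupation-number representation: the Hilbert
space of square-summable families of amplitudes, `ψ n` being the component of `ψ` along the
normalized symmetric basis vector with `n x` particles at each site `x`. -/
abbrev Fock (ι : Type) : Type := lp (fun _ : Occ ι => ℂ) 2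

/-- The annihilation operator `a_x`, with `a_x |n⟩ = √(n_x) |n - e_x⟩`, on families of amplitudes.
(The operators `a_x`, `a_x^*`, `H` are unbounded; each amplitude of the image is a finite
combination of amplitudes of the argument, so they are written on all families of amplitudes.) -/
def annihilation (x : ι) : (Occ ι → ℂ) →ₗ[ℂ] (Occ ι → ℂ) where
  toFun ψ n := (Real.sqrt ((n x : ℝ) + 1) : ℂ) * ψ (n + Pi.single x 1)
  map_add' ψ φ := by funext n; simp [mul_add]
  map_smul' c ψ := by funext n; simp [mul_left_comm]

/-- The creation operator `a_x^*`, with `a_x^* |n⟩ = √(n_x + 1) |n + e_x⟩`. (If `n x = 0`, the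
prefactor is zero, so the truncated subtraction plays no role.) -/
def creation (x : ι) : (Occ ι → ℂ) →ₗ[ℂ] (Occ ι → ℂ) where
  toFun ψ n := (Real.sqrt (n x : ℝ) : ℂ) * ψ (n - Pi.single x 1)
  map_add' ψ φ := by funext n; simp [mul_add]
  map_smul' c ψ := by funext n; simp [mul_left_comm]

/-- The number operator `n_x = a_x^* a_x`. -/
def number (x : ι) : (Occ ι → ℂ) →ₗ[ℂ] (Occ ι → ℂ) := creation x ∘ₗ annihilation x

/-- `n_x` is diagonal in the occupation-number basis, with the occupation numbers as eigenvalues. -/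
theorem number_apply (x : ι) (ψ : Occ ι → ℂ) (n : Occ ι) : number x ψ n = (n x : ℂ) * ψ n := by
  simp only [number, LinearMap.comp_apply, creation, annihilation, LinearMap.coe_mk, AddHom.coe_mk]
  rcases Nat.eq_zero_or_pos (n x) with h | h
  · simp [h]
  · have h1 : n - Pi.single x 1 + Pi.single x 1 = n := by
      funext y
      rcases eq_or_ne y x with rfl | hy
      · simp; omega
      · simp [hy]
    have h2 : (((n - Pi.single x 1 : Occ ι) x : ℕ) : ℝ) + 1 = n x := by
      have : (n - Pi.single x 1 : Occ ι) x = n x - 1 := by simp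
      rw [this, Nat.cast_sub h]; simp
    rw [h1, h2, ← mul_assoc, ← Complex.ofReal_mul, Real.mul_self_sqrt (Nat.cast_nonneg _)]
    simp

variable [Fintype ι]

/-- The density-density interaction `V = Φ({n_x})`, for a function `Φ` of the occupation numbers. -/
def interaction (Φ : Occ ι → ℝ) : (Occ ι → ℂ) →ₗ[ℂ] (Occ ι → ℂ) where
  toFun ψ n := (Φ n : ℂ) * ψ n
  map_add' ψ φ := by funext n; simp [mul_add]
  map_smul' c ψ := by funext n; simp [mul_left_comm]

/-- The Hamiltonian `H = ∑_{x,y} J_{xy} a_x^* a_y + V`. -/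
def hamiltonian (J : Matrix ι ι ℂ) (Φ : Occ ι → ℝ) : (Occ ι → ℂ) →ₗ[ℂ] (Occ ι → ℂ) :=
  (∑ x, ∑ y, J x y • (creation x ∘ₗ annihilation y)) + interaction Φ

/-- The configurations with `N` particles in total. -/
abbrev Sector (ι : Type) [Fintype ι] (N : ℕ) : Type := {n : Occ ι // ∑ x, n x = N}

instance sectorFintype (N : ℕ) : Fintype (Sector ι N) :=
  Fintype.subtype (Finset.piAntidiag Finset.univ N) (by intro n; simp [Finset.mem_piAntidiag])

/-- The matrix of the (finite-dimensional) `N`-particle block of the Hamiltonian in the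
occupation-number basis. The Hamiltonian conserves the number of particles, so it is the direct sum
of these blocks. -/
def sectorHamiltonian (J : Matrix ι ι ℂ) (Φ : Occ ι → ℝ) (N : ℕ) :
    Matrix (Sector ι N) (Sector ι N) ℂ :=
  fun n m => hamiltonian J Φ (Pi.single m.1 1) n.1

/-- The amplitudes of `e^{-itH} ψ`: in each `N`-particle sector, the matrix exponential
`exp(-it H_N)` is applied to the `N`-particle component of `ψ`. -/
def evolveAmp (J : Matrix ι ι ℂ) (Φ : Occ ι → ℝ) (t : ℝ) (ψ : Occ ι → ℂ) : Occ ι → ℂ :=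
  fun n => (NormedSpace.exp ((-(Complex.I * t)) • sectorHamiltonian J Φ (∑ x, n x))).mulVec
    (fun m => ψ m.1) ⟨n, rfl⟩

theorem hop_apply_comm (x y : ι) (n m : Occ ι) :
    (creation x ∘ₗ annihilation y) (Pi.single m (1 : ℂ)) n =
      (creation y ∘ₗ annihilation x) (Pi.single n (1 : ℂ)) m := by
  have key : ∀ (x y : ι) (n m : Occ ι), 0 < n x → n - Pi.single x 1 + Pi.single y 1 = m →
      (creation x ∘ₗ annihilation y) (Pi.single m (1 : ℂ)) n =
        (creation y ∘ₗ annihilation x) (Pi.single n (1 : ℂ)) m := by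
    intro x y n m hx h
    obtain ⟨k, rfl⟩ : ∃ k : Occ ι, n = k + Pi.single x 1 := by
      refine ⟨n - Pi.single x 1, ?_⟩
      funext z
      rcases eq_or_ne z x with rfl | hz
      · simp; omega
      · simp [hz]
    rw [add_tsub_cancel_right] at h
    subst h
    simp [creation, annihilation, mul_comm]
  by_cases h1 : 0 < n x ∧ n - Pi.single x 1 + Pi.single y 1 = m
  · exact key x y n m h1.1 h1.2
  · by_cases h2 : 0 < m y ∧ m - Pi.single y 1 + Pi.single x 1 = n
    · exact (key y x m n h2.1 h2.2).symm
    · have z1 : (creation x ∘ₗ annihilation y) (Pi.single m (1 : ℂ)) n = 0 := by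
        rcases Nat.eq_zero_or_pos (n x) with h | h
        · simp [creation, annihilation, h]
        · have : n - Pi.single x 1 + Pi.single y 1 ≠ m := fun h' => h1 ⟨h, h'⟩
          simp [creation, annihilation, Pi.single_apply, this]
      have z2 : (creation y ∘ₗ annihilation x) (Pi.single n (1 : ℂ)) m = 0 := by
        rcases Nat.eq_zero_or_pos (m y) with h | h
        · simp [creation, annihilation, h]
        · have : m - Pi.single y 1 + Pi.single x 1 ≠ n := fun h' => h2 ⟨h, h'⟩
          simp [creation, annihilation, Pi.single_apply, this]
      rw [z1, z2]

theorem star_hop_apply (x y : ι) (n m : Occ ι) :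
    star ((creation x ∘ₗ annihilation y) (Pi.single m (1 : ℂ)) n) =
      (creation x ∘ₗ annihilation y) (Pi.single m (1 : ℂ)) n := by
  simp only [creation, annihilation, LinearMap.comp_apply, LinearMap.coe_mk, AddHom.coe_mk,
    Pi.single_apply]
  split_ifs <;> simp

theorem sectorHamiltonian_isHermitian {J : Matrix ι ι ℂ} (hJ : J.IsHermitian) (Φ : Occ ι → ℝ)
    (N : ℕ) : (sectorHamiltonian J Φ N).IsHermitian := by
  ext n m
  simp only [Matrix.conjTranspose_apply, sectorHamiltonian, hamiltonian, LinearMap.add_apply,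
    LinearMap.sum_apply, Finset.sum_apply, Pi.add_apply, LinearMap.smul_apply, Pi.smul_apply,
    smul_eq_mul, star_add, star_sum, star_mul', star_hop_apply]
  congr 1
  · rw [Finset.sum_comm]
    refine Finset.sum_congr rfl fun y _ => Finset.sum_congr rfl fun x _ => ?_
    rw [hJ.apply, hop_apply_comm]
  · simp only [interaction, LinearMap.coe_mk, AddHom.coe_mk]
    rcases eq_or_ne n m with rfl | h
    · simp
    · have h1 : m.1 ≠ n.1 := fun h' => h (Subtype.ext h'.symm)
      simp [h1, h1.symm]

/-- The time evolution preserves the norm in each sector. -/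
theorem sum_norm_evolveAmp {J : Matrix ι ι ℂ} (hJ : J.IsHermitian) (Φ : Occ ι → ℝ) (t : ℝ)
    (ψ : Occ ι → ℂ) (N : ℕ) :
    ∑ n : Sector ι N, ‖evolveAmp J Φ t ψ n.1‖ ^ 2 = ∑ n : Sector ι N, ‖ψ n.1‖ ^ 2 := by
  set A := (-(Complex.I * t)) • sectorHamiltonian J Φ N with hA
  have hAs : A.conjTranspose = -A := by
    rw [hA, Matrix.conjTranspose_smul, (sectorHamiltonian_isHermitian hJ Φ N).eq, ← neg_smul]
    congr 1
    simp
  have hU : (NormedSpace.exp A).conjTranspose * NormedSpace.exp A = 1 := by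
    rw [← Matrix.exp_conjTranspose, hAs, ← Matrix.exp_add_of_commute (-A) A ((Commute.refl A).neg_left)]
    simp
  set w : Sector ι N → ℂ := fun m => ψ m.1
  have h1 : ∀ n : Sector ι N, evolveAmp J Φ t ψ n.1 = (NormedSpace.exp A).mulVec w n := by
    rintro ⟨n, rfl⟩
    rfl
  have h2 : ∀ u : Sector ι N → ℂ, ((∑ n, ‖u n‖ ^ 2 : ℝ) : ℂ) = star u ⬝ᵥ u := by
    intro u
    simp [dotProduct, Complex.conj_mul']
  have h3 : ((∑ n : Sector ι N, ‖evolveAmp J Φ t ψ n.1‖ ^ 2 : ℝ) : ℂ) =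
      ((∑ n : Sector ι N, ‖ψ n.1‖ ^ 2 : ℝ) : ℂ) := by
    simp_rw [h1]
    rw [h2 ((NormedSpace.exp A).mulVec w), h2 w, Matrix.star_mulVec, ← Matrix.dotProduct_mulVec,
      Matrix.mulVec_mulVec, hU, Matrix.one_mulVec]
  exact_mod_cast h3

theorem tsum_enorm_evolveAmp {J : Matrix ι ι ℂ} (hJ : J.IsHermitian) (Φ : Occ ι → ℝ) (t : ℝ)
    (ψ : Occ ι → ℂ) :
    ∑' n, ENNReal.ofReal (‖evolveAmp J Φ t ψ n‖ ^ 2) = ∑' n, ENNReal.ofReal (‖ψ n‖ ^ 2) := by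
  rw [← (Equiv.sigmaFiberEquiv fun n : Occ ι => ∑ x, n x).tsum_eq,
    ← (Equiv.sigmaFiberEquiv fun n : Occ ι => ∑ x, n x).tsum_eq, ENNReal.tsum_sigma',
    ENNReal.tsum_sigma']
  refine tsum_congr fun N => ?_
  have h := congrArg ENNReal.ofReal (sum_norm_evolveAmp hJ Φ t ψ N)
  rw [ENNReal.ofReal_sum_of_nonneg fun _ _ => by positivity,
    ENNReal.ofReal_sum_of_nonneg fun _ _ => by positivity] at h
  exact (tsum_fintype _ (L := _)).trans (h.trans (tsum_fintype _ (L := _)).symm)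

theorem evolveAmp_memℓp {J : Matrix ι ι ℂ} (hJ : J.IsHermitian) (Φ : Occ ι → ℝ) (t : ℝ)
    (ψ : Fock ι) : Memℓp (E := fun _ : Occ ι => ℂ) (evolveAmp J Φ t ψ) 2 := by
  have h2 : ∀ u : Occ ι → ℂ, Memℓp (E := fun _ : Occ ι => ℂ) u 2 ↔
      ∑' n, ENNReal.ofReal (‖u n‖ ^ 2) ≠ ⊤ := by
    intro u
    rw [memℓp_gen_iff (by norm_num)]
    simp only [ENNReal.toReal_ofNat, Real.rpow_ofNat]
    refine ⟨fun h => h.tsum_ofReal_ne_top, fun h => ?_⟩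
    have := ENNReal.summable_toReal h
    simpa [ENNReal.toReal_ofReal] using this
  rw [h2, tsum_enorm_evolveAmp hJ, ← h2]
  exact lp.memℓp ψ

/-- The solution `ψ_t = e^{-itH} ψ_0` of the Schrödinger equation `i ∂_t ψ_t = H ψ_t`. -/
def evolve {J : Matrix ι ι ℂ} (hJ : J.IsHermitian) (Φ : Occ ι → ℝ) (t : ℝ) (ψ : Fock ι) : Fock ι :=
  ⟨evolveAmp J Φ t ψ, evolveAmp_memℓp hJ Φ t ψ⟩

/-- The expectation `⟨N_X⟩_ψ = ⟨ψ, N_X ψ⟩` of `N_X = ∑_{x ∈ X} n_x`, in the sense of quadratic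
forms: since `N_X` is diagonal with eigenvalues `∑_{x ∈ X} n x`, this is a sum of nonnegative terms;
its value is `∞` exactly if `ψ` is not in the form domain of `N_X`. -/
def expNumber (X : Finset ι) (ψ : Fock ι) : ℝ≥0∞ :=
  ∑' n : Occ ι, ENNReal.ofReal ((∑ x ∈ X, (n x : ℝ)) * ‖ψ n‖ ^ 2)

/-- The domain of `N^{1/2}`, where `N = ∑_x n_x` is the total number operator. -/
def sqrtNumberDomain (ι : Type) [Fintype ι] : Set (Fock ι) :=
  {ψ | Memℓp (E := fun _ : Occ ι => ℂ) (fun n => (Real.sqrt (∑ x, (n x : ℝ)) : ℂ) * ψ n) 2}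

/-- The uniform density bound: `⟨N_X⟩_ψ ≤ l |X|` for every set `X` of sites. -/
def UniformDensityBound (l : ℝ) (ψ : Fock ι) : Prop :=
  ∀ X : Finset ι, expNumber X ψ ≤ ENNReal.ofReal (l * X.card)

end FockSpace

section Lattice

variable {d : ℕ}

/-- Any two distinct sites of `Λ` are at distance at least one. -/
def Separated (Λ : Finset (Space d)) : Prop :=
  ∀ x ∈ Λ, ∀ y ∈ Λ, x ≠ y → 1 ≤ dist x y

/-- The ball `B_h = {x ∈ Λ : |x| ≤ h}`. -/
def ball (Λ : Finset (Space d)) (h : ℝ) : Finset Λ :=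
  Finset.univ.filter fun x => ‖(x : Space d)‖ ≤ h

/-- Power-law decay of the hopping matrix: `|J_{xy}| ≤ C_J |x - y|^{-α}` for `x ≠ y`. -/
def PowerLawDecay {Λ : Finset (Space d)} (J : Matrix Λ Λ ℂ) (CJ α : ℝ) : Prop :=
  ∀ x y : Λ, x ≠ y → ‖J x y‖ ≤ CJ * dist (x : Space d) y ^ (-α)

/-- The first moment `sup_x ∑_y |J_{xy}| |x - y|` of the hopping matrix. -/
def firstMoment {Λ : Finset (Space d)} (J : Matrix Λ Λ ℂ) : ℝ :=
  ⨆ x : Λ, ∑ y : Λ, ‖J x y‖ * dist (x : Space d) y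

end Lattice

end BoseGas

end

/-!
Let `u x = ⟨n_x⟩`. The interaction commutes with all number operators, and `|⟨a_x^* a_y⟩|` is at
most `√(u x) √(u y)` by Cauchy–Schwarz, so for every weight `w` on the sites

  `|d/dt ∑ x, w x * u x| ≤ ∑ x, ∑ y, |w x - w y| * ‖J x y‖ * √(u x) * √(u y)`.

Hence it suffices to find a weight, depending on time, whose time derivative compensates the right
side for all densities `u ≥ 0` (`sum_weighted_sectorEvolve_le`). This is an argument in each
sector of fixed particle number, where everything is finite; the resulting bound is linear in the
initial densities, so that it can be summed over the sectors (`expNumber_evolve_le`).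

With `L = R - r`, the weight is `logistic ((|x| + V t - ρ₀) / s) + K(t) * (1 + |x| / L)^{-β}`
(`exists_front_weight`), where `κ < V < v`.

* The logistic front has the property that `|f x - f y|` is at most the geometric mean of the
  slopes at `x` and `y` times `|x - y| * exp (|x - y| / (2 s))` (`abs_logistic_sub_le`). For hops
  over less than `η s`, with `η` small, the Schur test bounds the current by `κ * exp (η / 2) ≤ V`
  times the slope, and this is exactly what the motion of the front at velocity `V` compensates.
  No remainder of higher order is left.
* The rate of the longer hops is of order `s^{d - α}`, which is `L^{-(d + 1)}` for
  `s = L^{(d + 1) / (α - d)}`. Their contribution is at most `L^{-(d + 1)}` times the expectation of the algebraic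
  weight, which itself grows at a rate of order `1 / L` only, since its relative variation over a
  hop is of order `|x - y| / L`. So a coefficient `K(t)` of order `L^{-d}`, decaying at a rate of
  order `1 / L`, absorbs them (`sum_current_nonpos`). The exponent `β = (α - 1) / 2` satisfies
  both `β > d`, which makes `L^{-d} ∑ x, (1 + |x| / L)^{-β}` bounded, and `d + 1 + β < α`, which
  the growth estimate needs; this is the condition `α > 2 d + 1`, which also gives `s ≪ L`.

As `s` is smaller than `L` by a power of `L`, the front differs from the indicator function of a
ball by exponentially small amounts at distances of order `L`, and the initial density bound at
single sites turns the algebraic weight into the error `C λ`.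
-/

namespace BoseGas

/-! ### The evolution in a sector of fixed particle number -/

section Fock

variable {ι : Type} [DecidableEq ι] [Fintype ι]

/-- The matrix elements of `a_x^* a_y`. The condition says that `n` arises from `m` by a hop from
`y` to `x`; it is written without subtraction, as the prefactor vanishes if
`n x = 0` or `m y = 0`. -/
theorem hop_single_apply (x y : ι) (n m : Occ ι) :
    (creation x ∘ₗ annihilation y) (Pi.single m (1 : ℂ)) n =
      if n + Pi.single y 1 = m + Pi.single x 1 then
        ((Real.sqrt (n x) * Real.sqrt (m y) : ℝ) : ℂ) else 0 := by
  rcases Nat.eq_zero_or_pos (n x) with h | h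
  · simp [creation, annihilation, h]
  · obtain ⟨k, rfl⟩ : ∃ k : Occ ι, n = k + Pi.single x 1 := by
      refine ⟨n - Pi.single x 1, ?_⟩
      funext z
      rcases eq_or_ne z x with rfl | hz
      · simp; omega
      · simp [hz]
    have e : k + Pi.single x 1 + Pi.single y 1 = m + Pi.single x 1 ↔ m = k + Pi.single y 1 := by
      rw [add_right_comm, add_left_inj, eq_comm]
    by_cases hm : m = k + Pi.single y 1
    · subst hm
      simp [creation, annihilation, add_right_comm]
    · rw [if_neg (by rwa [e])]
      simp [creation, annihilation, Pi.single_apply, Ne.symm hm]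

/-- The second quantization `∑ x, w x * n x` of a weight `w` on the sites, evaluated at the
configuration `n`. -/
noncomputable def weighted (w : ι → ℝ) (n : Occ ι) : ℝ := ∑ x, w x * (n x : ℝ)

/-- The density `⟨n_x⟩` of an `N`-particle state `φ`, which need not be normalized. -/
noncomputable def sectorDensity {N : ℕ} (φ : Sector ι N → ℂ) (x : ι) : ℝ :=
  ∑ n, (n.1 x : ℝ) * ‖φ n‖ ^ 2

theorem sectorDensity_nonneg {N : ℕ} (φ : Sector ι N → ℂ) (x : ι) : 0 ≤ sectorDensity φ x :=
  Finset.sum_nonneg fun _ _ => by positivity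

theorem sum_weighted_mul_norm_sq {N : ℕ} (φ : Sector ι N → ℂ) (w : ι → ℝ) :
    ∑ n, weighted w n.1 * ‖φ n‖ ^ 2 = ∑ x, w x * sectorDensity φ x := by
  simp only [weighted, sectorDensity, Finset.sum_mul, Finset.mul_sum]
  rw [Finset.sum_comm]
  simp only [mul_assoc]

theorem weighted_add_single (w : ι → ℝ) (n : Occ ι) (x : ι) :
    weighted w (n + Pi.single x 1) = weighted w n + w x := by
  simp [weighted, mul_add, Finset.sum_add_distrib, Pi.single_apply]

/-- The commutator of the Hamiltonian with a weighted number operator involves only the hopping,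
and each hop from `y` to `x` changes the weight by `w x - w y`. -/
theorem sub_mul_sectorHamiltonian (J : Matrix ι ι ℂ) (Φ : Occ ι → ℝ) (N : ℕ) (w : ι → ℝ)
    (n m : Sector ι N) :
    ((weighted w n.1 - weighted w m.1 : ℝ) : ℂ) * sectorHamiltonian J Φ N n m =
      ∑ x, ∑ y, ((w x - w y : ℝ) : ℂ) * J x y *
        (creation x ∘ₗ annihilation y) (Pi.single m.1 (1 : ℂ)) n.1 := by
  simp only [sectorHamiltonian, hamiltonian, LinearMap.add_apply, LinearMap.sum_apply,
    Finset.sum_apply, Pi.add_apply, LinearMap.smul_apply, Pi.smul_apply, smul_eq_mul, mul_add,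
    Finset.mul_sum]
  have hd : ((weighted w n.1 - weighted w m.1 : ℝ) : ℂ) *
      interaction Φ (Pi.single m.1 (1 : ℂ)) n.1 = 0 := by
    by_cases h : n.1 = m.1
    · simp [h]
    · simp [interaction, h]
  rw [hd, add_zero]
  refine Finset.sum_congr rfl fun x _ => Finset.sum_congr rfl fun y _ => ?_
  rw [hop_single_apply]
  split_ifs with h
  · have := congrArg (weighted w) h
    rw [weighted_add_single, weighted_add_single] at this
    rw [show weighted w n.1 - weighted w m.1 = w x - w y by linarith]
    ring
  · simp

/-- Cauchy–Schwarz for the one-particle density matrix: `|⟨a_x^* a_y⟩| ≤ √⟨n_x⟩ √⟨n_y⟩`. -/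
theorem norm_sum_hop_le {N : ℕ} (φ : Sector ι N → ℂ) (x y : ι) :
    ‖∑ n, ∑ m, star (φ n) * (creation x ∘ₗ annihilation y) (Pi.single m.1 (1 : ℂ)) n.1 * φ m‖ ≤
      Real.sqrt (sectorDensity φ x) * Real.sqrt (sectorDensity φ y) := by
  classical
  -- A configuration `n` is connected by the hop to at most one `m`, and conversely.
  set S : Finset (Sector ι N × Sector ι N) :=
    Finset.univ.filter fun p => p.1.1 + Pi.single y 1 = p.2.1 + Pi.single x 1 with hS
  have h1 : ‖∑ n, ∑ m, star (φ n) *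
      (creation x ∘ₗ annihilation y) (Pi.single m.1 (1 : ℂ)) n.1 * φ m‖ ≤
      ∑ p ∈ S, (Real.sqrt (p.1.1 x) * ‖φ p.1‖) * (Real.sqrt (p.2.1 y) * ‖φ p.2‖) := by
    rw [← Fintype.sum_prod_type', hS, Finset.sum_filter]
    refine (norm_sum_le _ _).trans (Finset.sum_le_sum fun p _ => ?_)
    rw [hop_single_apply]
    split_ifs with h
    · rw [norm_mul, norm_mul, norm_star, Complex.norm_real, Real.norm_of_nonneg (by positivity)]
      apply le_of_eq
      ring
    · simp
  have sq : ∀ (z : ι) (n : Sector ι N),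
      (Real.sqrt (n.1 z) * ‖φ n‖) ^ 2 = (n.1 z : ℝ) * ‖φ n‖ ^ 2 := fun z n => by
    rw [mul_pow, Real.sq_sqrt (Nat.cast_nonneg _)]
  have h2 : ∑ p ∈ S, (Real.sqrt (p.1.1 x) * ‖φ p.1‖) ^ 2 ≤ sectorDensity φ x := by
    simp only [sq]
    rw [sectorDensity, ← Finset.sum_image (s := S) (g := Prod.fst)
      (f := fun n : Sector ι N => (n.1 x : ℝ) * ‖φ n‖ ^ 2)]
    · exact Finset.sum_le_sum_of_subset_of_nonneg (Finset.subset_univ _)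
        fun _ _ _ => by positivity
    · rintro ⟨n, m⟩ hp ⟨n', m'⟩ hq h
      simp only [hS, Finset.coe_filter, Finset.mem_univ, true_and, Set.mem_ofPred_eq] at hp hq h
      subst h
      rw [hp, add_left_inj] at hq
      rw [Subtype.ext hq]
  have h3 : ∑ p ∈ S, (Real.sqrt (p.2.1 y) * ‖φ p.2‖) ^ 2 ≤ sectorDensity φ y := by
    simp only [sq]
    rw [sectorDensity, ← Finset.sum_image (s := S) (g := Prod.snd)
      (f := fun n : Sector ι N => (n.1 y : ℝ) * ‖φ n‖ ^ 2)]
    · exact Finset.sum_le_sum_of_subset_of_nonneg (Finset.subset_univ _)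
        fun _ _ _ => by positivity
    · rintro ⟨n, m⟩ hp ⟨n', m'⟩ hq h
      simp only [hS, Finset.coe_filter, Finset.mem_univ, true_and, Set.mem_ofPred_eq] at hp hq h
      subst h
      rw [← hp, add_left_inj] at hq
      rw [Subtype.ext hq]
  calc _ ≤ _ := h1
    _ ≤ _ := Real.sum_mul_le_sqrt_mul_sqrt _ _ _
    _ ≤ _ := by gcongr

/-- The expectation of the commutator of `H` with a weighted number operator is at most the largest
current that the densities allow. -/
theorem norm_commutator_le (J : Matrix ι ι ℂ) (Φ : Occ ι → ℝ) {N : ℕ} (w : ι → ℝ)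
    (φ : Sector ι N → ℂ) :
    ‖∑ n, ∑ m, star (φ n) * (((weighted w n.1 - weighted w m.1 : ℝ) : ℂ) *
        sectorHamiltonian J Φ N n m) * φ m‖ ≤
      ∑ x, ∑ y, |w x - w y| * ‖J x y‖ *
        (Real.sqrt (sectorDensity φ x) * Real.sqrt (sectorDensity φ y)) := by
  have e : ∑ n, ∑ m, star (φ n) * (((weighted w n.1 - weighted w m.1 : ℝ) : ℂ) *
        sectorHamiltonian J Φ N n m) * φ m =
      ∑ x, ∑ y, ((w x - w y : ℝ) : ℂ) * J x y * ∑ n : Sector ι N, ∑ m : Sector ι N, star (φ n) *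
        (creation x ∘ₗ annihilation y) (Pi.single m.1 (1 : ℂ)) n.1 * φ m := by
    simp only [sub_mul_sectorHamiltonian, Finset.mul_sum, Finset.sum_mul]
    rw [Finset.sum_congr rfl fun n _ => Finset.sum_comm]
    rw [Finset.sum_comm]
    refine Finset.sum_congr rfl fun x _ => ?_
    rw [Finset.sum_congr rfl fun n _ => Finset.sum_comm]
    rw [Finset.sum_comm]
    refine Finset.sum_congr rfl fun y _ => Finset.sum_congr rfl fun n _ =>
      Finset.sum_congr rfl fun m _ => ?_
    ring
  rw [e]
  refine (norm_sum_le _ _).trans (Finset.sum_le_sum fun x _ =>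
    (norm_sum_le _ _).trans (Finset.sum_le_sum fun y _ => ?_))
  rw [norm_mul, norm_mul, Complex.norm_real, Real.norm_eq_abs]
  gcongr
  exact norm_sum_hop_le φ x y

/-- The `N`-particle component of `e^{-itH} ψ`. -/
noncomputable def sectorEvolve (J : Matrix ι ι ℂ) (Φ : Occ ι → ℝ) (N : ℕ) (φ : Sector ι N → ℂ)
    (t : ℝ) : Sector ι N → ℂ :=
  (NormedSpace.exp ((-(Complex.I * t)) • sectorHamiltonian J Φ N)).mulVec φ

theorem evolveAmp_eq_sectorEvolve (J : Matrix ι ι ℂ) (Φ : Occ ι → ℝ) (t : ℝ) (ψ : Occ ι → ℂ)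
    {N : ℕ} (n : Sector ι N) :
    evolveAmp J Φ t ψ n.1 = sectorEvolve J Φ N (fun m => ψ m.1) t n := by
  obtain ⟨n, rfl⟩ := n
  rfl

theorem sectorEvolve_zero (J : Matrix ι ι ℂ) (Φ : Occ ι → ℝ) (N : ℕ) (φ : Sector ι N → ℂ) :
    sectorEvolve J Φ N φ 0 = φ := by
  simp [sectorEvolve]

open scoped Matrix.Norms.Operator in
theorem hasDerivAt_sectorEvolve (J : Matrix ι ι ℂ) (Φ : Occ ι → ℝ) (N : ℕ) (φ : Sector ι N → ℂ)
    (t : ℝ) (n : Sector ι N) :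
    HasDerivAt (fun t => sectorEvolve J Φ N φ t n)
      (-Complex.I * ∑ m, sectorHamiltonian J Φ N n m * sectorEvolve J Φ N φ t m) t := by
  set H := sectorHamiltonian J Φ N
  have e : ∀ t : ℝ, (-(Complex.I * t)) • H = t • ((-Complex.I) • H) := fun t => by
    ext i j
    simp
    ring
  have h := hasDerivAt_exp_smul_const' (𝕂 := ℝ) ((-Complex.I) • H) t
  let ev : Matrix (Sector ι N) (Sector ι N) ℂ →L[ℝ] ℂ :=
    LinearMap.toContinuousLinearMap
      { toFun := fun A => A.mulVec φ n
        map_add' := fun A B => by simp [Matrix.add_mulVec]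
        map_smul' := fun c A => by simp [Matrix.smul_mulVec] }
  have h2 := ev.hasFDerivAt.comp_hasDerivAt t h
  have h3 : (fun t => sectorEvolve J Φ N φ t n) =
      ev ∘ fun u : ℝ => NormedSpace.exp (u • ((-Complex.I) • H)) := by
    funext u
    simp only [sectorEvolve, Function.comp, ev]
    rw [e]
    rfl
  rw [h3]
  refine h2.congr_deriv ?_
  symm
  change _ = Matrix.mulVec (((-Complex.I) • H) * NormedSpace.exp (t • ((-Complex.I) • H))) φ n
  rw [← Matrix.mulVec_mulVec, ← e, Matrix.smul_mulVec]
  rfl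

/-- The time derivative of the expectation of a time-dependent weighted number operator. -/
theorem hasDerivAt_sum_weighted {J : Matrix ι ι ℂ} (hJ : J.IsHermitian) (Φ : Occ ι → ℝ) {N : ℕ}
    (φ : Sector ι N → ℂ) {w w' : ℝ → ι → ℝ} (t : ℝ)
    (hw : ∀ x, HasDerivAt (fun t => w t x) (w' t x) t) :
    HasDerivAt (fun t => ∑ n : Sector ι N, weighted (w t) n.1 * ‖sectorEvolve J Φ N φ t n‖ ^ 2)
      (∑ n : Sector ι N, weighted (w' t) n.1 * ‖sectorEvolve J Φ N φ t n‖ ^ 2 +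
        (∑ n : Sector ι N, ∑ m : Sector ι N, star (sectorEvolve J Φ N φ t n) *
          (((weighted (w t) n.1 - weighted (w t) m.1 : ℝ) : ℂ) *
          sectorHamiltonian J Φ N n m) * sectorEvolve J Φ N φ t m).im) t := by
  set H := sectorHamiltonian J Φ N with hH
  set ψ := sectorEvolve J Φ N φ t with hψ
  have hW : ∀ n : Sector ι N, HasDerivAt (fun t => weighted (w t) n.1) (weighted (w' t) n.1) t :=
    fun n => HasDerivAt.fun_sum fun x _ => (hw x).mul_const _
  have hd : ∀ n : Sector ι N, HasDerivAt (fun t => ‖sectorEvolve J Φ N φ t n‖ ^ 2)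
      (2 * (star (ψ n) * ∑ m, H n m * ψ m).im) t := fun n => by
    have h := (hasDerivAt_sectorEvolve J Φ N φ t n).norm_sq
    convert h using 1
    rw [Complex.inner]
    simp [← hψ, ← hH]
    ring
  have := HasDerivAt.fun_sum fun n (_ : n ∈ (Finset.univ : Finset (Sector ι N))) =>
    (hW n).mul (hd n)
  refine this.congr_deriv ?_
  rw [Finset.sum_add_distrib]
  congr 1
  -- Antisymmetrize, using that `H` is Hermitian.
  set c : Sector ι N → Sector ι N → ℝ := fun n m => (star (ψ n) * H n m * ψ m).im with hc
  have hanti : ∀ n m, c n m = - c m n := fun n m => by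
    have hs : star (ψ n) * H n m * ψ m = star (star (ψ m) * H m n * ψ n) := by
      rw [star_mul', star_mul', star_star,
        (sectorHamiltonian_isHermitian hJ Φ N).apply n m]
      ring
    simp only [hc]
    rw [hs]
    simp only [Complex.star_def, Complex.conj_im]
  have h1 : ∑ n : Sector ι N, weighted (w t) n.1 * (2 * (star (ψ n) * ∑ m, H n m * ψ m).im) =
      ∑ n : Sector ι N, ∑ m, weighted (w t) n.1 * c n m +
      ∑ n : Sector ι N, ∑ m, weighted (w t) n.1 * c n m := by
    rw [← Finset.sum_add_distrib]
    refine Finset.sum_congr rfl fun n _ => ?_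
    rw [← two_mul, ← Finset.mul_sum, Finset.mul_sum, Complex.im_sum]
    simp only [hc, mul_assoc]
    ring
  have h2 : ∑ n : Sector ι N, ∑ m, weighted (w t) n.1 * c n m =
      ∑ n : Sector ι N, ∑ m : Sector ι N, -(weighted (w t) m.1 * c n m) := by
    rw [Finset.sum_comm]
    refine Finset.sum_congr rfl fun n _ => Finset.sum_congr rfl fun m _ => ?_
    rw [hanti]
    ring
  rw [h1]
  nth_rewrite 2 [h2]
  rw [← Finset.sum_add_distrib, Complex.im_sum]
  refine Finset.sum_congr rfl fun n _ => ?_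
  rw [← Finset.sum_add_distrib, Complex.im_sum]
  refine Finset.sum_congr rfl fun m _ => ?_
  rw [show star (ψ n) * (((weighted (w t) n.1 - weighted (w t) m.1 : ℝ) : ℂ) * H n m) * ψ m =
    ((weighted (w t) n.1 - weighted (w t) m.1 : ℝ) : ℂ) * (star (ψ n) * H n m * ψ m) by ring,
    Complex.im_ofReal_mul]
  ring

/-- Monotonicity of a time-dependent observable: if the time derivative of the weight absorbs the
largest current that the hopping allows for the given densities, then the expectation of the
weighted number operator does not increase. -/
theorem sum_weighted_sectorEvolve_le {J : Matrix ι ι ℂ} (hJ : J.IsHermitian) (Φ : Occ ι → ℝ)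
    {N : ℕ} (φ : Sector ι N → ℂ) {w w' : ℝ → ι → ℝ} {T : ℝ} (hT : 0 ≤ T)
    (hw : ∀ t x, HasDerivAt (fun t => w t x) (w' t x) t)
    (hcur : ∀ t ∈ Set.Icc 0 T, ∀ u : ι → ℝ, (∀ x, 0 ≤ u x) →
      ∑ x, w' t x * u x +
        ∑ x, ∑ y, |w t x - w t y| * ‖J x y‖ * (Real.sqrt (u x) * Real.sqrt (u y)) ≤ 0) :
    ∑ n : Sector ι N, weighted (w T) n.1 * ‖sectorEvolve J Φ N φ T n‖ ^ 2 ≤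
      ∑ n : Sector ι N, weighted (w 0) n.1 * ‖φ n‖ ^ 2 := by
  have hd := fun t => hasDerivAt_sum_weighted hJ Φ φ t (hw t)
  have hanti := antitoneOn_of_deriv_nonpos (convex_Icc 0 T)
    (f := fun t => ∑ n : Sector ι N, weighted (w t) n.1 * ‖sectorEvolve J Φ N φ t n‖ ^ 2)
    (fun t _ => (hd t).continuousAt.continuousWithinAt)
    (fun t _ => (hd t).differentiableAt.differentiableWithinAt)
    (fun t ht => by
      rw [interior_Icc] at ht
      rw [(hd t).deriv, sum_weighted_mul_norm_sq]
      refine le_trans ?_ (hcur t (Set.Ioo_subset_Icc_self ht)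
        (sectorDensity (sectorEvolve J Φ N φ t)) (sectorDensity_nonneg _))
      gcongr
      exact (Complex.abs_im_le_norm _).trans' (le_abs_self _) |>.trans
        (norm_commutator_le J Φ (w t) _))
  have := hanti (Set.left_mem_Icc.2 hT) (Set.right_mem_Icc.2 hT) hT
  simpa only [sectorEvolve_zero] using this

end Fock

/-! ### Lattice sums over separated sets -/

section LatticeSums

open MeasureTheory

variable {d : ℕ}

/-- Comparison of a lattice sum with an integral: the balls of radius `1/2` around the sites are
disjoint. -/
theorem exists_sum_one_add_div_rpow_le (d : ℕ) {p : ℝ} (hp : (d : ℝ) < p) :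
    ∃ C : ℝ, 0 < C ∧ ∀ Λ : Finset (Space d), Separated Λ → ∀ (z : Space d) (L : ℝ), 1 ≤ L →
      ∑ x ∈ Λ, (1 + dist x z / L) ^ (-p) ≤ C * L ^ (d : ℝ) := by
  have hp0 : 0 < p := lt_of_le_of_lt (Nat.cast_nonneg d) hp
  set I : ℝ := ∫ y : Space d, (1 + ‖y‖) ^ (-p) with hI
  set c : ℝ := (volume : Measure (Space d)).real (Metric.ball 0 (1 / 2)) with hc
  have hint : Integrable (fun y : Space d => (1 + ‖y‖) ^ (-p)) :=
    integrable_one_add_norm (by simpa using hp)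
  have hI0 : 0 ≤ I := integral_nonneg fun y => by positivity
  have hc0 : 0 < c := ENNReal.toReal_pos
    (Metric.measure_ball_pos _ _ (by norm_num)).ne' measure_ball_lt_top.ne
  refine ⟨c⁻¹ * 2 ^ p * I + 1, by positivity, fun Λ hΛ z L hL => ?_⟩
  have hL0 : 0 < L := by linarith
  set F : Space d → ℝ := fun y => (1 + dist y z / L) ^ (-p) with hF
  have hFeq : F = fun y => (fun u : Space d => (1 + ‖L⁻¹ • u‖) ^ (-p)) (y - z) := by
    funext y
    simp only [hF]
    rw [norm_smul, norm_inv, Real.norm_of_nonneg hL0.le, dist_eq_norm, div_eq_inv_mul]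
  have hFint : Integrable F := by
    rw [hFeq]
    exact (hint.comp_smul (inv_ne_zero hL0.ne')).comp_sub_right z
  have hF0 : ∀ y, 0 ≤ F y := fun y => by positivity
  have hFI : ∫ y, F y = L ^ (d : ℝ) * I := by
    rw [hFeq, integral_sub_right_eq_self (fun u : Space d => (1 + ‖L⁻¹ • u‖) ^ (-p)) z,
      Measure.integral_comp_inv_smul_of_nonneg _ (fun u : Space d => (1 + ‖u‖) ^ (-p)) hL0.le]
    simp [hI]
  have hball : ∀ x ∈ Λ, c * F x ≤ 2 ^ p * ∫ y in Metric.ball x (1 / 2), F y := fun x _ => by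
    have hvol : (volume : Measure (Space d)).real (Metric.ball x (1 / 2)) = c := by
      simp only [Measure.real, hc, Measure.addHaar_ball_center]
    rw [← integral_const_mul, ← hvol, ← smul_eq_mul, ← setIntegral_const]
    refine setIntegral_mono_on (integrableOn_const measure_ball_lt_top.ne)
      (hFint.const_mul _).integrableOn measurableSet_ball fun y hy => ?_
    have h1 : dist y z / L ≤ dist x z / L + 1 := by
      rw [← div_self hL0.ne', ← add_div]
      have := dist_triangle y x z
      rw [Metric.mem_ball] at hy
      gcongr
      linarith
    have h0 : 0 ≤ dist x z / L := by positivity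
    have h0' : 0 ≤ dist y z / L := by positivity
    have h2 : (2 * (1 + dist x z / L)) ^ (-p) ≤ F y :=
      Real.rpow_le_rpow_of_nonpos (by positivity) (by linarith) (by linarith)
    rw [Real.mul_rpow (by norm_num) (by positivity), Real.rpow_neg (by norm_num),
      inv_mul_le_iff₀ (by positivity)] at h2
    exact h2
  have hsum : ∑ x ∈ Λ, ∫ y in Metric.ball x (1 / 2), F y ≤ ∫ y, F y := by
    rw [← integral_biUnion_finset Λ (fun _ _ => measurableSet_ball) _
      (fun _ _ => hFint.integrableOn)]
    · exact setIntegral_le_integral hFint (Filter.Eventually.of_forall hF0)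
    · intro x hx y hy hxy
      exact Metric.ball_disjoint_ball (by norm_num; exact hΛ x hx y hy hxy)
  have h3 : c * ∑ x ∈ Λ, F x ≤ 2 ^ p * (L ^ (d : ℝ) * I) := by
    rw [Finset.mul_sum, ← hFI]
    refine (Finset.sum_le_sum hball).trans ?_
    rw [← Finset.mul_sum]
    gcongr
  rw [← le_div_iff₀' hc0] at h3
  refine h3.trans ?_
  rw [div_eq_inv_mul]
  have : 0 < L ^ (d : ℝ) := by positivity
  nlinarith

/-- Tails of power-law lattice sums, at distance at least `h`. -/
theorem exists_sum_dist_rpow_le (d : ℕ) {p : ℝ} (hp : (d : ℝ) < p) :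
    ∃ C : ℝ, 0 < C ∧ ∀ Λ : Finset (Space d), Separated Λ → ∀ (x : Λ) (h : ℝ), 0 < h →
      ∑ y : Λ with y ≠ x ∧ h ≤ dist (x : Space d) y, dist (x : Space d) y ^ (-p) ≤
        C * h ^ (d - p) := by
  have hp0 : 0 < p := lt_of_le_of_lt (Nat.cast_nonneg d) hp
  obtain ⟨C, hC, hS⟩ := exists_sum_one_add_div_rpow_le d hp
  refine ⟨C * 2 ^ p, by positivity, fun Λ hΛ x h hh => ?_⟩
  -- Distinct sites are at distance at least one, so `h` may be replaced by `max h 1`.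
  set k := max h 1 with hk
  have hk1 : 1 ≤ k := le_max_right _ _
  have hk0 : 0 < k := by linarith
  have hterm : ∀ y : Λ, y ≠ x ∧ h ≤ dist (x : Space d) y → dist (x : Space d) y ^ (-p) ≤
      (2 ^ p * k ^ (-p)) * (1 + dist (y : Space d) x / k) ^ (-p) := fun y hy => by
    have hky : k ≤ dist (x : Space d) y :=
      max_le hy.2 (hΛ _ x.2 _ y.2 fun e => hy.1 (Subtype.ext e.symm))
    have h1 : k / 2 * (1 + dist (y : Space d) x / k) ≤ dist (x : Space d) y := by
      rw [dist_comm (y : Space d)]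
      field_simp
      linarith
    have h2 := Real.rpow_le_rpow_of_nonpos (by positivity) h1 (show -p ≤ 0 by linarith)
    refine h2.trans_eq ?_
    rw [Real.mul_rpow (by positivity) (by positivity), Real.div_rpow hk0.le (by norm_num),
      Real.rpow_neg (show (0 : ℝ) ≤ 2 by norm_num), div_inv_eq_mul, mul_comm (k ^ (-p))]
  calc ∑ y : Λ with y ≠ x ∧ h ≤ dist (x : Space d) y, dist (x : Space d) y ^ (-p)
      ≤ ∑ y : Λ with y ≠ x ∧ h ≤ dist (x : Space d) y,
          (2 ^ p * k ^ (-p)) * (1 + dist (y : Space d) x / k) ^ (-p) :=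
        Finset.sum_le_sum fun y hy => hterm y (Finset.mem_filter.1 hy).2
    _ ≤ ∑ y : Λ, (2 ^ p * k ^ (-p)) * (1 + dist (y : Space d) x / k) ^ (-p) :=
        Finset.sum_le_sum_of_subset_of_nonneg (Finset.filter_subset _ _)
          fun _ _ _ => by positivity
    _ = (2 ^ p * k ^ (-p)) * ∑ y ∈ Λ, (1 + dist y (x : Space d) / k) ^ (-p) := by
        rw [← Finset.mul_sum, ← Finset.sum_coe_sort Λ]
    _ ≤ (2 ^ p * k ^ (-p)) * (C * k ^ (d : ℝ)) := by
        gcongr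
        exact hS Λ hΛ x k hk1
    _ = C * 2 ^ p * k ^ (d - p) := by
        rw [sub_eq_add_neg, Real.rpow_add hk0]
        ring
    _ ≤ C * 2 ^ p * h ^ (d - p) := by
        exact mul_le_mul_of_nonneg_left
          (Real.rpow_le_rpow_of_nonpos hh (le_max_left _ _) (by linarith)) (by positivity)

variable {Λ : Finset (Space d)} {J : Matrix Λ Λ ℂ}

theorem sum_norm_mul_dist_le_firstMoment (x : Λ) :
    ∑ y : Λ, ‖J x y‖ * dist (x : Space d) y ≤ firstMoment J :=
  le_ciSup (f := fun x : Λ => ∑ y : Λ, ‖J x y‖ * dist (x : Space d) y)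
    (Set.finite_range _).bddAbove x

theorem firstMoment_nonneg : 0 ≤ firstMoment J :=
  Real.iSup_nonneg fun _ => Finset.sum_nonneg fun _ _ => by positivity

/-- The hopping over distances of at least `h`, weighted with the growth that an algebraic weight
of exponent `β` and scale `L` may have over the distance. -/
theorem exists_sum_far_le (d : ℕ) {α CJ β : ℝ} (hCJ : 0 < CJ) (hβ : 0 ≤ β) (hα : d + β < α) :
    ∃ C : ℝ, 0 < C ∧ ∀ Λ : Finset (Space d), Separated Λ → ∀ J : Matrix Λ Λ ℂ,
      PowerLawDecay J CJ α → ∀ (x : Λ) (h L : ℝ), 0 < h → h ≤ L →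
      ∑ y : Λ with y ≠ x ∧ h ≤ dist (x : Space d) y,
        (1 + dist (x : Space d) y / L) ^ β * ‖J x y‖ ≤ C * h ^ (d - α) := by
  obtain ⟨C, hC, hS⟩ := exists_sum_dist_rpow_le d (p := α - β) (by linarith)
  refine ⟨2 ^ β * CJ * C, by positivity, fun Λ hΛ J hJ x h L hh hL => ?_⟩
  have hL0 : 0 < L := hh.trans_le hL
  calc _ ≤ ∑ y : Λ with y ≠ x ∧ h ≤ dist (x : Space d) y,
          (2 ^ β * CJ * h ^ (-β)) * dist (x : Space d) y ^ (-(α - β)) := by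
        refine Finset.sum_le_sum fun y hy => ?_
        obtain ⟨hyx, hy⟩ := (Finset.mem_filter.1 hy).2
        set δ := dist (x : Space d) y
        have hδ : 0 < δ := by linarith
        have h1 : 1 + δ / L ≤ 2 * (δ / h) := by
          have : δ / L ≤ δ / h := by gcongr
          have : 1 ≤ δ / h := by rwa [one_le_div hh]
          linarith
        have h2 : (1 + δ / L) ^ β ≤ 2 ^ β * (δ ^ β * h ^ (-β)) := by
          refine (Real.rpow_le_rpow (by positivity) h1 hβ).trans_eq ?_
          rw [Real.mul_rpow (by norm_num) (by positivity), Real.div_rpow hδ.le hh.le,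
            Real.rpow_neg hh.le, div_eq_mul_inv]
        calc _ ≤ 2 ^ β * (δ ^ β * h ^ (-β)) * (CJ * δ ^ (-α)) := by
              gcongr
              exact hJ x y hyx.symm
          _ = _ := by
              rw [neg_sub, sub_eq_add_neg, Real.rpow_add hδ]
              ring
    _ ≤ (2 ^ β * CJ * h ^ (-β)) * (C * h ^ (d - (α - β))) := by
        rw [← Finset.mul_sum]
        gcongr
        exact hS Λ hΛ x h hh
    _ = _ := by
        rw [show (d : ℝ) - α = -β + (d - (α - β)) by ring, Real.rpow_add hh]
        ring

/-- The first moment of the hopping, weighted with the growth that an algebraic weight of exponent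
`β` and scale `L` may have over the distance. -/
theorem exists_sum_dist_mul_le (d : ℕ) {α CJ β : ℝ} (hCJ : 0 < CJ) (hβ : 0 ≤ β)
    (hα : d + 1 + β < α) :
    ∃ C : ℝ, 0 < C ∧ ∀ Λ : Finset (Space d), Separated Λ → ∀ J : Matrix Λ Λ ℂ,
      PowerLawDecay J CJ α → ∀ (x : Λ) (L : ℝ), 1 ≤ L →
      ∑ y : Λ, dist (x : Space d) y * (1 + dist (x : Space d) y / L) ^ β * ‖J x y‖ ≤ C := by
  obtain ⟨C, hC, hS⟩ := exists_sum_dist_rpow_le d (p := α - 1 - β) (by linarith)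
  refine ⟨2 ^ β * CJ * C, by positivity, fun Λ hΛ J hJ x L hL => ?_⟩
  have hsplit : ∑ y : Λ, dist (x : Space d) y * (1 + dist (x : Space d) y / L) ^ β * ‖J x y‖ =
      ∑ y : Λ with y ≠ x ∧ 1 ≤ dist (x : Space d) y,
        dist (x : Space d) y * (1 + dist (x : Space d) y / L) ^ β * ‖J x y‖ := by
    refine (Finset.sum_filter_of_ne fun y _ hy => ?_).symm
    have hyx : y ≠ x := by
      rintro rfl
      simp at hy
    exact ⟨hyx, hΛ _ x.2 _ y.2 fun e => hyx (Subtype.ext e.symm)⟩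
  rw [hsplit]
  calc _ ≤ ∑ y : Λ with y ≠ x ∧ 1 ≤ dist (x : Space d) y,
          (2 ^ β * CJ) * dist (x : Space d) y ^ (-(α - 1 - β)) := by
        refine Finset.sum_le_sum fun y hy => ?_
        obtain ⟨hyx, hy⟩ := (Finset.mem_filter.1 hy).2
        set δ := dist (x : Space d) y
        have hδ : 0 < δ := by linarith
        have h1 : 1 + δ / L ≤ 2 * δ := by
          have : δ / L ≤ δ := div_le_self hδ.le hL
          linarith
        have h2 : (1 + δ / L) ^ β ≤ 2 ^ β * δ ^ β := by
          refine (Real.rpow_le_rpow (by positivity) h1 hβ).trans_eq ?_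
          rw [Real.mul_rpow (by norm_num) (by positivity)]
        calc _ ≤ δ * (2 ^ β * δ ^ β) * (CJ * δ ^ (-α)) := by
              gcongr
              exact hJ x y hyx.symm
          _ = _ := by
              rw [show -(α - 1 - β) = 1 + β + -α by ring, Real.rpow_add hδ, Real.rpow_add hδ,
                Real.rpow_one]
              ring
    _ ≤ (2 ^ β * CJ) * (C * 1 ^ (d - (α - 1 - β))) := by
        rw [← Finset.mul_sum]
        gcongr
        exact hS Λ hΛ x 1 one_pos
    _ = _ := by rw [Real.one_rpow]; ring

end LatticeSums

/-! ### The logistic and the algebraic weight -/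

section Weights

/-- The Schur test for a symmetric kernel. -/
theorem sum_sum_mul_le_of_symm {ι : Type*} [Fintype ι] {K : ι → ι → ℝ} (hK : ∀ x y, 0 ≤ K x y)
    (hs : ∀ x y, K x y = K y x) (a : ι → ℝ) :
    ∑ x, ∑ y, K x y * (a x * a y) ≤ ∑ x, (∑ y, K x y) * a x ^ 2 := by
  have h : ∑ x, ∑ y, K x y * a y ^ 2 = ∑ x, ∑ y, K x y * a x ^ 2 := by
    rw [Finset.sum_comm]
    exact Finset.sum_congr rfl fun x _ => Finset.sum_congr rfl fun y _ => by rw [hs]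
  have h2 : ∑ x, ∑ y, K x y * (a x * a y) ≤
      ∑ x, ∑ y, (1 / 2 * (K x y * a x ^ 2) + 1 / 2 * (K x y * a y ^ 2)) := by
    refine Finset.sum_le_sum fun x _ => Finset.sum_le_sum fun y _ => ?_
    nlinarith [mul_nonneg (hK x y) (sq_nonneg (a x - a y))]
  refine h2.trans_eq ?_
  simp only [Finset.sum_add_distrib, ← Finset.mul_sum, h, Finset.sum_mul]
  ring

/-- The logistic profile of the front. -/
noncomputable def logistic (p : ℝ) : ℝ := (1 + Real.exp p)⁻¹

/-- The square root of `-logistic'`. -/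
noncomputable def sqrtSlope (p : ℝ) : ℝ := Real.exp (p / 2) / (1 + Real.exp p)

theorem logistic_pos (p : ℝ) : 0 < logistic p := by unfold logistic; positivity

theorem logistic_le_one (p : ℝ) : logistic p ≤ 1 := by
  have := Real.exp_pos p
  exact inv_le_one_of_one_le₀ (by linarith)

theorem logistic_le_exp_neg (p : ℝ) : logistic p ≤ Real.exp (-p) := by
  rw [Real.exp_neg, logistic]
  exact inv_anti₀ (Real.exp_pos p) (by linarith)

theorem hasDerivAt_logistic (p : ℝ) : HasDerivAt logistic (-(sqrtSlope p ^ 2)) p := by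
  have h := ((Real.hasDerivAt_exp p).const_add 1).inv (by positivity)
  refine h.congr_deriv ?_
  rw [sqrtSlope, div_pow, ← Real.exp_nat_mul]
  simp only [Nat.cast_ofNat]
  rw [mul_div_cancel₀ _ (by norm_num : (2 : ℝ) ≠ 0), neg_div]

/-- The increments of the logistic profile are controlled by the geometric mean of the slopes at
the two end points, with the sharp constant for small increments. -/
theorem abs_logistic_sub_le (p q : ℝ) :
    |logistic p - logistic q| ≤
      |p - q| * Real.exp (|p - q| / 2) * (sqrtSlope p * sqrtSlope q) := by
  wlog h : p ≤ q generalizing p q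
  · rw [abs_sub_comm, abs_sub_comm p q, mul_comm (sqrtSlope p)]
    exact this q p (le_of_not_ge h)
  have hp := Real.exp_pos p
  have hq := Real.exp_pos q
  have hpq : Real.exp p ≤ Real.exp q := Real.exp_le_exp.2 h
  have h1 : logistic p - logistic q =
      (Real.exp q - Real.exp p) / ((1 + Real.exp p) * (1 + Real.exp q)) := by
    unfold logistic
    field_simp
    ring
  rw [h1, abs_of_nonneg (div_nonneg (by linarith) (by positivity)), abs_sub_comm,
    abs_of_nonneg (sub_nonneg.2 h), sqrtSlope, sqrtSlope, div_mul_div_comm, ← mul_div_assoc]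
  gcongr
  have e1 : Real.exp p = Real.exp q * Real.exp (p - q) := by rw [← Real.exp_add]; ring_nf
  have e2 : Real.exp ((q - p) / 2) * (Real.exp (p / 2) * Real.exp (q / 2)) = Real.exp q := by
    rw [← Real.exp_add, ← Real.exp_add]; ring_nf
  rw [mul_assoc, e2, e1]
  nlinarith [Real.add_one_le_exp (p - q)]

/-- The algebraically decaying weight `(1 + ρ / L)^{-β}`. -/
noncomputable def algWeight (β L ρ : ℝ) : ℝ := (1 + ρ / L) ^ (-β)

theorem algWeight_pos {β L ρ : ℝ} (hL : 0 < L) (hρ : 0 ≤ ρ) : 0 < algWeight β L ρ := by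
  unfold algWeight; positivity

/-- The algebraic weight varies at most polynomially, on the scale `L`. -/
theorem algWeight_le_mul {β L ρ σ δ : ℝ} (hβ : 0 ≤ β) (hL : 0 < L) (hρ : 0 ≤ ρ) (hσ : 0 ≤ σ)
    (h : ρ ≤ σ + δ) (hδ : 0 ≤ δ) :
    algWeight β L σ ≤ (1 + δ / L) ^ β * algWeight β L ρ := by
  unfold algWeight
  have h1 : 1 + ρ / L ≤ (1 + δ / L) * (1 + σ / L) := by
    have : ρ / L ≤ σ / L + δ / L := by rw [← add_div]; gcongr
    have : 0 ≤ δ / L * (σ / L) := by positivity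
    nlinarith
  rw [Real.rpow_neg (by positivity), Real.rpow_neg (by positivity), ← div_eq_mul_inv,
    le_div_iff₀ (by positivity), inv_mul_le_iff₀ (by positivity), mul_comm,
    ← Real.mul_rpow (by positivity) (by positivity)]
  exact Real.rpow_le_rpow (by positivity) h1 hβ

/-- The increments of the algebraic weight are of relative size `δ / L`, up to the polynomial growth
of the weight over the distance `δ`. -/
theorem abs_algWeight_sub_le {β L ρ σ δ : ℝ} (hβ : 1 ≤ β) (hL : 0 < L) (hρ : 0 ≤ ρ) (hσ : 0 ≤ σ)
    (h : |ρ - σ| ≤ δ) :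
    |algWeight β L ρ - algWeight β L σ| ≤
      β / L * (δ * (1 + δ / L) ^ β) * algWeight β L ρ := by
  have hδ : 0 ≤ δ := (abs_nonneg _).trans h
  -- The relative increment, by Bernoulli's inequality.
  have key : ∀ {a b : ℝ}, 0 ≤ a → a ≤ b → b ≤ a + δ →
      algWeight β L a - algWeight β L b ≤ β * δ / L * algWeight β L a := by
    intro a b ha hab hb
    have hA : 0 < 1 + a / L := by positivity
    have hB : 1 ≤ 1 + b / L := by
      have : 0 ≤ b / L := div_nonneg (by linarith) hL.le
      linarith
    have hab' : a / L ≤ b / L := by gcongr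
    have hd : b / L - a / L ≤ δ / L := by rw [← sub_div]; gcongr; linarith
    set s : ℝ := (1 + a / L) / (1 + b / L) - 1 with hs
    have hs1 : -(δ / L) ≤ s := by
      have : s = -(b / L - a / L) / (1 + b / L) := by
        rw [hs, eq_div_iff (by linarith), sub_mul, div_mul_cancel₀ _ (by linarith)]
        ring
      rw [this, le_div_iff₀ (by linarith)]
      nlinarith [div_nonneg hδ hL.le]
    have hs0 : -1 ≤ s := by
      have : 0 ≤ (1 + a / L) / (1 + b / L) := by positivity
      linarith
    have hbern := one_add_mul_self_le_rpow_one_add hs0 hβ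
    rw [hs, add_sub_cancel, ← hs, Real.div_rpow hA.le (by linarith)] at hbern
    have hmul : algWeight β L b =
        (1 + a / L) ^ β / (1 + b / L) ^ β * algWeight β L a := by
      unfold algWeight
      rw [Real.rpow_neg hA.le, Real.rpow_neg (by linarith)]
      field_simp
    rw [hmul]
    have hg := algWeight_pos (β := β) hL ha
    have : 1 - β * (δ / L) ≤ (1 + a / L) ^ β / (1 + b / L) ^ β := by nlinarith
    rw [mul_div_assoc]
    nlinarith
  have h1 : 1 ≤ (1 + δ / L) ^ β := by
    refine Real.one_le_rpow ?_ (by linarith)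
    have : 0 ≤ δ / L := by positivity
    linarith
  have hanti : ∀ {a b : ℝ}, 0 ≤ a → a ≤ b → algWeight β L b ≤ algWeight β L a :=
    fun {a b} ha hab => Real.rpow_le_rpow_of_nonpos (by positivity) (by gcongr) (by linarith)
  obtain ⟨hl, hr⟩ := abs_le.1 h
  have hg := algWeight_pos (β := β) hL hρ
  have e : ∀ c : ℝ, β / L * (δ * (1 + δ / L) ^ β) * c = β * δ / L * ((1 + δ / L) ^ β * c) :=
    fun c => by ring
  rw [e]
  rcases le_total ρ σ with hle | hle
  · rw [abs_of_nonneg (sub_nonneg.2 (hanti hρ hle))]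
    refine (key hρ hle (by linarith)).trans ?_
    gcongr
    exact le_mul_of_one_le_left hg.le h1
  · rw [abs_sub_comm, abs_of_nonneg (sub_nonneg.2 (hanti hσ hle))]
    refine (key hσ hle (by linarith)).trans ?_
    gcongr
    exact algWeight_le_mul (by linarith) hL hρ hσ (by linarith) hδ

end Weights

/-! ### Current bounds for the two weights -/

section Current

variable {d : ℕ} {Λ : Finset (Space d)} {J : Matrix Λ Λ ℂ}

/-- The current of the weight `logistic ∘ θ + K * algWeight` is absorbed by a front of velocity `V`
and by a decay of the algebraic part. Hops over less than `η * s` see the slope of the logistic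
front, which the motion of the front compensates; longer hops, and all hops in the algebraic part,
are controlled by the algebraic weight. -/
theorem sum_current_nonpos (hJ : J.IsHermitian) {s η V L β K M F A Cf : ℝ} {θ : Λ → ℝ}
    (hs : 0 < s) (hL : 0 < L) (hβ : 1 ≤ β) (hK : 0 ≤ K) (hCf : 0 ≤ Cf)
    (hθ : ∀ x y : Λ, |θ x - θ y| ≤ dist (x : Space d) y / s)
    (hf : ∀ x : Λ, logistic (θ x) ≤ Cf * algWeight β L ‖(x : Space d)‖)
    (hnear : Real.exp (η / 2) * firstMoment J ≤ V)
    (hfar : ∀ x : Λ, ∑ y : Λ with y ≠ x ∧ η * s ≤ dist (x : Space d) y,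
      (1 + dist (x : Space d) y / L) ^ β * ‖J x y‖ ≤ F)
    (htail : ∀ x : Λ, ∑ y : Λ, dist (x : Space d) y * (1 + dist (x : Space d) y / L) ^ β * ‖J x y‖
      ≤ A)
    (hM : 2 * Cf * F + K * (β / L * A) ≤ M) {u : Λ → ℝ} (hu : ∀ x, 0 ≤ u x) :
    ∑ x : Λ, (-(V / s * sqrtSlope (θ x) ^ 2) - M * algWeight β L ‖(x : Space d)‖) * u x +
      ∑ x : Λ, ∑ y : Λ, |logistic (θ x) + K * algWeight β L ‖(x : Space d)‖ -
        (logistic (θ y) + K * algWeight β L ‖(y : Space d)‖)| * ‖J x y‖ *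
          (Real.sqrt (u x) * Real.sqrt (u y)) ≤ 0 := by
  classical
  set g : Λ → ℝ := fun x => algWeight β L ‖(x : Space d)‖ with hg
  have hg0 : ∀ x, 0 < g x := fun x => algWeight_pos hL (norm_nonneg _)
  have hJs : ∀ x y, ‖J x y‖ = ‖J y x‖ := fun x y => by rw [← hJ.apply x y, norm_star]
  have hρ : ∀ x y : Λ, |‖(x : Space d)‖ - ‖(y : Space d)‖| ≤ dist (x : Space d) y := fun x y => by
    rw [dist_eq_norm]
    exact abs_norm_sub_norm_le _ _
  set far : Λ → Λ → Prop := fun x y => y ≠ x ∧ η * s ≤ dist (x : Space d) y with hfardef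
  -- `K₁` is the kernel of the short hops in the front, `K₂` that of all the other hops.
  set K₁ : Λ → Λ → ℝ := fun x y =>
    Real.exp (η / 2) / s * (‖J x y‖ * dist (x : Space d) y) with hK₁
  set K₂ : Λ → Λ → ℝ := fun x y =>
    (if far x y then Cf * (g x + g y) * ‖J x y‖ else 0) + K * (|g x - g y| * ‖J x y‖) with hK₂
  have hpt : ∀ x y, |logistic (θ x) + K * g x - (logistic (θ y) + K * g y)| * ‖J x y‖ ≤
      K₁ x y * (sqrtSlope (θ x) * sqrtSlope (θ y)) + K₂ x y := fun x y => by
    have hsl : ∀ p, 0 < sqrtSlope p := fun p => by unfold sqrtSlope; positivity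
    have h1 : |logistic (θ x) + K * g x - (logistic (θ y) + K * g y)| ≤
        |logistic (θ x) - logistic (θ y)| + K * |g x - g y| := by
      rw [← abs_of_nonneg hK, ← abs_mul, abs_of_nonneg hK]
      refine le_trans (le_of_eq ?_) (abs_add_le _ _)
      ring_nf
    have h2 : |logistic (θ x) - logistic (θ y)| * ‖J x y‖ ≤
        K₁ x y * (sqrtSlope (θ x) * sqrtSlope (θ y)) +
          (if far x y then Cf * (g x + g y) * ‖J x y‖ else 0) := by
      have hpos : 0 ≤ K₁ x y * (sqrtSlope (θ x) * sqrtSlope (θ y)) := by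
        have := hsl (θ x)
        have := hsl (θ y)
        positivity
      split_ifs with hxy
      · have : |logistic (θ x) - logistic (θ y)| ≤ Cf * (g x + g y) := by
          rw [abs_le]
          constructor <;>
          linarith [logistic_pos (θ x), logistic_pos (θ y), hf x, hf y,
            mul_nonneg hCf (hg0 x).le, mul_nonneg hCf (hg0 y).le]
        have := mul_le_mul_of_nonneg_right this (norm_nonneg (J x y))
        linarith
      · by_cases hyx : y = x
        · subst hyx
          simpa using hpos
        · have hd : dist (x : Space d) y ≤ η * s := by
            by_contra hcon
            exact hxy ⟨hyx, by linarith⟩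
          have h3 : |θ x - θ y| ≤ η :=
            (hθ x y).trans ((div_le_iff₀ hs).2 hd)
          have h4 : |logistic (θ x) - logistic (θ y)| ≤ dist (x : Space d) y / s *
              Real.exp (η / 2) * (sqrtSlope (θ x) * sqrtSlope (θ y)) := by
            refine (abs_logistic_sub_le _ _).trans ?_
            have := hsl (θ x)
            have := hsl (θ y)
            gcongr
            exact hθ x y
          calc _ ≤ _ := mul_le_mul_of_nonneg_right h4 (norm_nonneg (J x y))
            _ = _ := by simp only [hK₁]; ring
    calc _ ≤ _ := mul_le_mul_of_nonneg_right h1 (norm_nonneg (J x y))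
      _ ≤ _ := by simp only [hK₂]; linarith
  have hsum : ∑ x : Λ, ∑ y : Λ, |logistic (θ x) + K * g x - (logistic (θ y) + K * g y)| *
      ‖J x y‖ * (Real.sqrt (u x) * Real.sqrt (u y)) ≤
      ∑ x : Λ, ∑ y : Λ, K₁ x y * ((sqrtSlope (θ x) * Real.sqrt (u x)) *
        (sqrtSlope (θ y) * Real.sqrt (u y))) +
      ∑ x : Λ, ∑ y : Λ, K₂ x y * (Real.sqrt (u x) * Real.sqrt (u y)) := by
    rw [← Finset.sum_add_distrib]
    refine Finset.sum_le_sum fun x _ => ?_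
    rw [← Finset.sum_add_distrib]
    refine Finset.sum_le_sum fun y _ => ?_
    refine (mul_le_mul_of_nonneg_right (hpt x y) (by positivity)).trans_eq ?_
    ring
  have hS₁ := sum_sum_mul_le_of_symm (K := K₁) (fun x y => by positivity)
    (fun x y => by simp only [hK₁]; rw [hJs, dist_comm])
    (fun x => sqrtSlope (θ x) * Real.sqrt (u x))
  have hS₂ := sum_sum_mul_le_of_symm (K := K₂)
    (fun x y => by
      have := hg0 x
      have := hg0 y
      simp only [hK₂]
      split_ifs <;> positivity)
    (fun x y => by
      have : far x y ↔ far y x := by simp only [hfardef]; rw [dist_comm, ne_comm]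
      simp only [hK₂, this]
      rw [hJs, add_comm (g x), abs_sub_comm])
    (fun x => Real.sqrt (u x))
  have hrow₁ : ∀ x, ∑ y, K₁ x y ≤ V / s := fun x => by
    simp only [hK₁]
    rw [← Finset.mul_sum, div_mul_eq_mul_div]
    gcongr
    refine le_trans ?_ hnear
    gcongr
    exact sum_norm_mul_dist_le_firstMoment x
  have hrow₂ : ∀ x, ∑ y, K₂ x y ≤ M * g x := fun x => by
    simp only [hK₂]
    rw [Finset.sum_add_distrib, ← Finset.sum_filter, ← Finset.mul_sum]
    have h1 : ∑ y : Λ with far x y, Cf * (g x + g y) * ‖J x y‖ ≤ 2 * Cf * g x * F := by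
      refine le_trans ?_ (mul_le_mul_of_nonneg_left (hfar x)
        (mul_nonneg (mul_nonneg zero_le_two hCf) (hg0 x).le))
      rw [Finset.mul_sum]
      refine Finset.sum_le_sum fun y _ => ?_
      have h2 : g y ≤ (1 + dist (x : Space d) y / L) ^ β * g x :=
        algWeight_le_mul (by linarith) hL (norm_nonneg _) (norm_nonneg _)
          (by linarith [(abs_le.1 (hρ x y)).2]) dist_nonneg
      have h3 : g x ≤ (1 + dist (x : Space d) y / L) ^ β * g x :=
        le_mul_of_one_le_left (hg0 x).le (Real.one_le_rpow
          (le_add_of_nonneg_right (by positivity)) (by linarith))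
      calc _ ≤ Cf * ((1 + dist (x : Space d) y / L) ^ β * g x +
            (1 + dist (x : Space d) y / L) ^ β * g x) * ‖J x y‖ := by gcongr
        _ = _ := by ring
    have h4 : ∑ y : Λ, |g x - g y| * ‖J x y‖ ≤ β / L * g x * A := by
      refine le_trans ?_ (mul_le_mul_of_nonneg_left (htail x)
        (mul_nonneg (div_nonneg (by linarith) hL.le) (hg0 x).le))
      rw [Finset.mul_sum]
      refine Finset.sum_le_sum fun y _ => ?_
      refine (mul_le_mul_of_nonneg_right (abs_algWeight_sub_le hβ hL (norm_nonneg _)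
        (norm_nonneg _) (hρ x y)) (norm_nonneg _)).trans_eq ?_
      ring
    have h5 := mul_le_mul_of_nonneg_left h4 hK
    have h6 := mul_le_mul_of_nonneg_right hM (hg0 x).le
    linarith
  have hB₁ : ∑ x, (∑ y, K₁ x y) * (sqrtSlope (θ x) * Real.sqrt (u x)) ^ 2 ≤
      ∑ x, V / s * sqrtSlope (θ x) ^ 2 * u x := by
    refine Finset.sum_le_sum fun x _ => ?_
    rw [mul_pow, Real.sq_sqrt (hu x), mul_assoc]
    exact mul_le_mul_of_nonneg_right (hrow₁ x) (mul_nonneg (sq_nonneg _) (hu x))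
  have hB₂ : ∑ x, (∑ y, K₂ x y) * Real.sqrt (u x) ^ 2 ≤ ∑ x, M * g x * u x := by
    refine Finset.sum_le_sum fun x _ => ?_
    rw [Real.sq_sqrt (hu x)]
    exact mul_le_mul_of_nonneg_right (hrow₂ x) (hu x)
  have hE : ∑ x : Λ, (-(V / s * sqrtSlope (θ x) ^ 2) - M * g x) * u x =
      -(∑ x, V / s * sqrtSlope (θ x) ^ 2 * u x) - ∑ x, M * g x * u x := by
    rw [← Finset.sum_neg_distrib, ← Finset.sum_sub_distrib]
    exact Finset.sum_congr rfl fun x _ => by ring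
  rw [hE]
  linarith

end Current

/-! ### Choice of constants -/

section Constants

theorem exists_exp_neg_mul_le {c : ℝ} (hc : 0 < c) (m : ℝ) :
    ∃ C : ℝ, 0 < C ∧ ∀ X : ℝ, 1 ≤ X → Real.exp (-(c * X)) ≤ C * X ^ (-m) := by
  obtain ⟨k, hk⟩ := exists_nat_ge m
  refine ⟨k.factorial / c ^ k, by positivity, fun X hX => ?_⟩
  have hX0 : 0 < X := by linarith
  have h := Real.pow_div_factorial_le_exp (x := c * X) (by positivity) k
  rw [Real.exp_neg]
  have h1 : X ^ (-(k : ℝ)) ≤ X ^ (-m) := Real.rpow_le_rpow_of_exponent_le hX (by linarith)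
  calc (Real.exp (c * X))⁻¹ ≤ ((c * X) ^ k / k.factorial)⁻¹ := inv_anti₀ (by positivity) h
    _ = k.factorial / c ^ k * X ^ (-(k : ℝ)) := by
        rw [Real.rpow_neg hX0.le, Real.rpow_natCast, mul_pow]
        field_simp
    _ ≤ _ := by gcongr

theorem exists_mul_exp_half_le {κ V : ℝ} (h : κ < V) :
    ∃ η : ℝ, 0 < η ∧ η ≤ 1 ∧ Real.exp (η / 2) * κ ≤ V := by
  have hcont : Filter.Tendsto (fun η : ℝ => Real.exp (η / 2) * κ) (nhdsWithin 0 (Set.Ioi 0))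
      (nhds κ) := by
    have : Continuous fun η : ℝ => Real.exp (η / 2) * κ := by fun_prop
    simpa using (this.tendsto 0).mono_left nhdsWithin_le_nhds
  obtain ⟨η, h1, h2⟩ := ((hcont.eventually (gt_mem_nhds h)).and
    (Ioc_mem_nhdsGT (zero_lt_one' ℝ))).exists
  exact ⟨η, h2.1, h2.2, h1.le⟩

end Constants

/-! ### The moving front -/

section Front

theorem exists_exp_neg_div_le_algWeight (β : ℝ) :
    ∃ C : ℝ, 0 < C ∧ ∀ L ρ : ℝ, 0 < L → 0 ≤ ρ → Real.exp (-(ρ / L)) ≤ C * algWeight β L ρ := by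
  obtain ⟨C, hC, h⟩ := exists_exp_neg_mul_le one_pos β
  refine ⟨Real.exp 1 * C, by positivity, fun L ρ hL hρ => ?_⟩
  have h0 : 0 ≤ ρ / L := by positivity
  have e : Real.exp (-(ρ / L)) = Real.exp 1 * Real.exp (-(1 * (1 + ρ / L))) := by
    rw [← Real.exp_add]
    ring_nf
  rw [e, mul_assoc]
  gcongr
  exact h (1 + ρ / L) (by linarith)

/-- Beyond the radius `R`, a front of width `s ≤ L` which sits at distance at least `a` inside is
exponentially small in `a / s`. -/
theorem logistic_div_le {s L a R ρ p : ℝ} (hs : 0 < s) (hsL : s ≤ L) (hρ : R ≤ ρ)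
    (hp : a + (ρ - R) ≤ p) :
    logistic (p / s) ≤ Real.exp (-(a / s)) * Real.exp (-((ρ - R) / L)) := by
  refine (logistic_le_exp_neg _).trans ?_
  rw [← Real.exp_add, Real.exp_le_exp, ← neg_add, neg_le_neg_iff]
  calc a / s + (ρ - R) / L ≤ a / s + (ρ - R) / s := by
        have : 0 ≤ ρ - R := by linarith
        gcongr
    _ ≤ p / s := by
        rw [← add_div]
        gcongr

/-- The weights that prove the theorem: a logistic front, moving inwards at a velocity `V` between
`κ` and `v`, plus a small algebraic weight that decays in time and absorbs the long hops. Up to the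
final time the weight decreases along the evolution; at the final time it is essentially at least
`1` on `B_r`, and initially it is at most `1` on `B_R`, up to a weight `D` of bounded sum. -/
theorem exists_front_weight (d : ℕ) (hd : 1 ≤ d) {α CJ κ v δ₀ : ℝ} (hα : 2 * (d : ℝ) + 1 < α)
    (hCJ : 0 < CJ) (hκ : 0 ≤ κ) (hv : κ < v) (hδ₀ : 0 < δ₀) :
    ∃ C : ℝ, 0 < C ∧ ∀ Λ : Finset (Space d), Separated Λ → ∀ J : Matrix Λ Λ ℂ, J.IsHermitian →
      PowerLawDecay J CJ α → firstMoment J ≤ κ → ∀ R r T : ℝ, 0 < r → max (δ₀ * r) 1 < R - r →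
      0 ≤ T → T ≤ (R - r) / v →
      ∃ (w w' : ℝ → Λ → ℝ) (D : Λ → ℝ),
        (∀ t x, HasDerivAt (fun t => w t x) (w' t x) t) ∧
        (∀ t ∈ Set.Icc 0 T, ∀ u : Λ → ℝ, (∀ x, 0 ≤ u x) →
          ∑ x, w' t x * u x +
            ∑ x, ∑ y, |w t x - w t y| * ‖J x y‖ * (Real.sqrt (u x) * Real.sqrt (u y)) ≤ 0) ∧
        (∀ x, 0 ≤ w T x) ∧ (∀ x ∈ ball Λ r, 1 ≤ (1 + C * (R - r)⁻¹) * w T x) ∧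
        (∀ x, w 0 x ≤ (if x ∈ ball Λ R then 1 else 0) + D x) ∧
        (∀ x, 0 ≤ D x) ∧ ∑ x, D x ≤ C := by
  have hd1 : (1 : ℝ) ≤ d := by exact_mod_cast hd
  have hv0 : 0 < v := hκ.trans_lt hv
  -- The algebraic exponent must be summable, `d < β`, while the hopping weighted with the growth
  -- of the algebraic weight has a first moment, `d + 1 + β < α`.
  set β : ℝ := (α - 1) / 2 with hβdef
  have hβd : (d : ℝ) < β := by rw [hβdef]; linarith
  have hβ1 : 1 ≤ β := by linarith
  -- The width `s = L ^ q` of the front makes the rate of the hops over distances of order `s` or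
  -- more, which is of order `s ^ (d - α)`, equal to `L ^ (-(d + 1))`. By `α > 2 * d + 1`, the front
  -- is much narrower than the distance `L` that it travels.
  set q : ℝ := (d + 1) / (α - d) with hq
  have hαd : 0 < α - d := by linarith
  have hq0 : 0 < q := by positivity
  have hq1 : q < 1 := by rw [hq, div_lt_one hαd]; linarith
  set V : ℝ := (κ + v) / 2 with hV
  have hκV : κ < V := by rw [hV]; linarith
  have hV0 : 0 < V := hκ.trans_lt hκV
  set c : ℝ := (1 - V / v) / 2 with hc
  have hc0 : 0 < c := by
    have : V / v < 1 := by rw [div_lt_one hv0, hV]; linarith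
    rw [hc]; linarith
  obtain ⟨η, hη0, hη1, hηV⟩ := exists_mul_exp_half_le hκV
  obtain ⟨CS, hCS, hS⟩ := exists_sum_one_add_div_rpow_le d hβd
  obtain ⟨CF, hCF, hF⟩ := exists_sum_far_le d (α := α) (β := β) hCJ (by linarith)
    (by rw [hβdef]; linarith)
  obtain ⟨A, hA, htail⟩ := exists_sum_dist_mul_le d (α := α) (β := β) hCJ (by linarith)
    (by rw [hβdef]; linarith)
  obtain ⟨Ce, hCe, hexp⟩ := exists_exp_neg_div_le_algWeight β
  obtain ⟨CE, hCE, hexpE⟩ := exists_exp_neg_mul_le hc0 (d / (1 - q))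
  set Cf : ℝ := Real.exp (1 + δ₀⁻¹) * Ce with hCf
  have hCf0 : 0 < Cf := by positivity
  set μ : ℝ := β * A + 1 with hμ
  have hμ0 : 0 < μ := by positivity
  set K₀ : ℝ := 2 * Cf * (CF * η ^ (d - α)) * Real.exp (μ / v) with hK₀
  have hK₀0 : 0 < K₀ := by positivity
  refine ⟨CE + (CE * Cf + K₀) * CS, by positivity, ?_⟩
  intro Λ hΛ J hJ hJα hJκ R r T hr hRr hT0 hT
  set L : ℝ := R - r with hLdef
  have hL1 : 1 < L := (le_max_right _ _).trans_lt hRr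
  have hL0 : 0 < L := by linarith
  have hRL : R / L ≤ 1 + δ₀⁻¹ := by
    have h1 : δ₀ * r < L := (le_max_left _ _).trans_lt hRr
    rw [div_le_iff₀ hL0, show R = L + r by rw [hLdef]; ring, add_mul, one_mul]
    have : r ≤ δ₀⁻¹ * L := by
      rw [inv_mul_eq_div, le_div_iff₀ hδ₀]
      linarith
    linarith
  set s : ℝ := L ^ q with hs
  have hs0 : 0 < s := by positivity
  have hsL : s ≤ L := by
    simpa using Real.rpow_le_rpow_of_exponent_le hL1.le hq1.le
  have hLs : L / s = L ^ (1 - q) := by rw [Real.rpow_sub hL0, Real.rpow_one]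
  have hsα : s ^ (d - α) = L ^ (-(d : ℝ)) / L := by
    rw [hs, ← Real.rpow_mul hL0.le, ← Real.rpow_sub_one hL0.ne']
    congr 1
    rw [hq]
    field_simp
    ring
  -- The front starts at distance `c * L` inside `B_R` and ends at least `c * L` outside `B_r`; `E`
  -- bounds its tail at this distance.
  set E : ℝ := Real.exp (-(c * L / s)) with hE
  have hEL : E ≤ CE * L ^ (-(d : ℝ)) := by
    have h1 := hexpE (L ^ (1 - q)) (Real.one_le_rpow hL1.le (by linarith))
    rw [← Real.rpow_mul hL0.le, ← hLs, ← mul_div_assoc] at h1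
    rwa [show (1 - q) * -(d / (1 - q)) = -(d : ℝ) by
      have : 1 - q ≠ 0 := by linarith
      field_simp] at h1
  have hLd : L ^ (-(d : ℝ)) ≤ L⁻¹ := by
    rw [← Real.rpow_neg_one]
    exact Real.rpow_le_rpow_of_exponent_le hL1.le (by linarith)
  set ρ₀ : ℝ := R - c * L with hρ₀
  set g : Λ → ℝ := fun x => algWeight β L ‖(x : Space d)‖ with hg
  have hg0 : ∀ x, 0 < g x := fun x => algWeight_pos hL0 (norm_nonneg _)
  have hexpg : ∀ x : Λ, Real.exp (-((‖(x : Space d)‖ - R) / L)) ≤ Cf * g x := fun x => by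
    have e : Real.exp (-((‖(x : Space d)‖ - R) / L)) =
        Real.exp (R / L) * Real.exp (-(‖(x : Space d)‖ / L)) := by
      rw [← Real.exp_add]
      ring_nf
    rw [e, hCf, mul_assoc]
    gcongr
    exact hexp L _ hL0 (norm_nonneg _)
  set θ : ℝ → Λ → ℝ := fun t x => (‖(x : Space d)‖ + V * t - ρ₀) / s with hθ
  have hfout : ∀ x : Λ, ∀ t : ℝ, 0 ≤ t → R < ‖(x : Space d)‖ →
      logistic (θ t x) ≤ E * (Cf * g x) := fun x t ht hx => by
    refine (logistic_div_le hs0 hsL hx.le ?_).trans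
      (mul_le_mul_of_nonneg_left (hexpg x) (Real.exp_pos _).le)
    rw [hρ₀]
    linarith [mul_nonneg hV0.le ht]
  have hfg : ∀ x : Λ, ∀ t : ℝ, 0 ≤ t → logistic (θ t x) ≤ Cf * g x := fun x t ht => by
    rcases le_or_gt ‖(x : Space d)‖ R with hx | hx
    · refine (logistic_le_one _).trans (le_trans ?_ (hexpg x))
      rw [Real.one_le_exp_iff, neg_nonneg]
      exact div_nonpos_of_nonpos_of_nonneg (by linarith) hL0.le
    · refine (hfout x t ht hx).trans ?_
      have hE1 : E ≤ 1 := by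
        rw [hE, Real.exp_le_one_iff, neg_nonpos]
        positivity
      exact mul_le_of_le_one_left (mul_nonneg hCf0.le (hg0 x).le) hE1
  -- The coefficient of the algebraic weight is large enough to control the long hops until the time
  -- `L / v`, and its rate of decay `μ / L` exceeds the growth rate `β * A / L` of that weight.
  set K : ℝ → ℝ := fun t => K₀ * L ^ (-(d : ℝ)) * Real.exp (-(μ / L) * t) with hK
  have hK0 : ∀ t, 0 < K t := fun t => by positivity
  refine ⟨fun t x => logistic (θ t x) + K t * g x,
    fun t x => -(V / s * sqrtSlope (θ t x) ^ 2) - K t * (μ / L) * g x,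
    fun x => (CE * Cf + K₀) * L ^ (-(d : ℝ)) * g x, ?_, ?_, ?_, ?_, ?_, ?_, ?_⟩
  · intro t x
    have h1 : HasDerivAt (fun t => θ t x) (V / s) t := by
      simpa using ((((hasDerivAt_id t).const_mul V).const_add ‖(x : Space d)‖).sub_const
        ρ₀).div_const s
    have h2 := (hasDerivAt_logistic (θ t x)).comp t h1
    have h3 : HasDerivAt K (K₀ * L ^ (-(d : ℝ)) * (Real.exp (-(μ / L) * t) * -(μ / L))) t := by
      have h := (((hasDerivAt_id t).const_mul (-(μ / L))).exp).const_mul (K₀ * L ^ (-(d : ℝ)))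
      simpa only [id, mul_one] using h
    refine (h2.add (h3.mul_const (g x))).congr_deriv ?_
    simp only [hK]
    ring
  · intro t ht u hu
    refine sum_current_nonpos hJ (η := η) (K := K t) (Cf := Cf) (θ := θ t) (V := V)
      (F := CF * (η * s) ^ (d - α)) (A := A) hs0 hL0 hβ1
      (hK0 t).le hCf0.le (fun x y => ?_) (fun x => hfg x t ht.1) ?_
      (fun x => hF Λ hΛ J hJα x (η * s) L (by positivity)
        ((mul_le_of_le_one_left hs0.le hη1).trans hsL))
      (fun x => htail Λ hΛ J hJα x L hL1.le) ?_ hu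
    · simp only [hθ]
      rw [← sub_div, abs_div, abs_of_pos hs0, dist_eq_norm]
      gcongr
      refine le_trans (le_of_eq ?_) (abs_norm_sub_norm_le _ _)
      ring_nf
    · refine le_trans ?_ hηV
      gcongr
    · have ht1 : μ / L * t ≤ μ / v := by
        have : t ≤ L / v := ht.2.trans hT
        calc μ / L * t ≤ μ / L * (L / v) := by gcongr
          _ = μ / v := by field_simp
      have h1 : 2 * Cf * (CF * η ^ (d - α)) * L ^ (-(d : ℝ)) ≤ K t := by
        have h2 : (1 : ℝ) ≤ Real.exp (μ / v) * Real.exp (-(μ / L) * t) := by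
          rw [← Real.exp_add, Real.one_le_exp_iff]
          linarith
        calc _ = 2 * Cf * (CF * η ^ (d - α)) * L ^ (-(d : ℝ)) * 1 := (mul_one _).symm
          _ ≤ 2 * Cf * (CF * η ^ (d - α)) * L ^ (-(d : ℝ)) *
              (Real.exp (μ / v) * Real.exp (-(μ / L) * t)) := by gcongr
          _ = K t := by simp only [hK, hK₀]; ring
      rw [Real.mul_rpow hη0.le hs0.le, hsα]
      have h3 : 2 * Cf * (CF * (η ^ (d - α) * (L ^ (-(d : ℝ)) / L))) ≤ K t / L := by
        refine le_trans (le_of_eq ?_) (div_le_div_of_nonneg_right h1 hL0.le)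
        ring
      have h4 : K t * (μ / L) = K t / L + K t * (β / L * A) := by
        rw [hμ]
        ring
      linarith
  · intro x
    exact add_nonneg (logistic_pos _).le (mul_nonneg (hK0 T).le (hg0 x).le)
  · intro x hx
    have hx' : ‖(x : Space d)‖ ≤ r := (Finset.mem_filter.1 hx).2
    have hθE : Real.exp (θ T x) ≤ E := by
      rw [hE, Real.exp_le_exp]
      simp only [hθ]
      rw [← neg_div]
      gcongr
      have h1 : V * T ≤ V / v * L := by
        calc V * T ≤ V * (L / v) := by gcongr
          _ = _ := by ring
      have h2 : V / v = 1 - 2 * c := by rw [hc]; ring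
      rw [h2] at h1
      rw [hρ₀]
      linarith
    have hl : 1 ≤ (1 + E) * logistic (θ T x) := by
      unfold logistic
      rw [← div_eq_mul_inv, one_le_div (by positivity)]
      linarith
    have hEC : E ≤ (CE + (CE * Cf + K₀) * CS) * L⁻¹ := by
      refine hEL.trans ?_
      have h3 : CE * L ^ (-(d : ℝ)) ≤ CE * L⁻¹ := by gcongr
      have h4 : 0 ≤ (CE * Cf + K₀) * CS * L⁻¹ := by positivity
      linarith
    calc (1 : ℝ) ≤ (1 + E) * logistic (θ T x) := hl
      _ ≤ _ := by
        have := logistic_pos (θ T x)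
        have := mul_pos (hK0 T) (hg0 x)
        gcongr
        linarith
  · intro x
    have hK0' : K 0 = K₀ * L ^ (-(d : ℝ)) := by simp [hK]
    have hmem : x ∈ ball Λ R ↔ ‖(x : Space d)‖ ≤ R := by simp [ball]
    simp only [hK0', hmem]
    have hgx := hg0 x
    split_ifs with hx
    · have h1 := logistic_le_one (θ 0 x)
      have h2 : 0 ≤ CE * Cf * L ^ (-(d : ℝ)) * g x := by positivity
      linarith
    · have h1 := hfout x 0 le_rfl (not_le.1 hx)
      have h2 : E * (Cf * g x) ≤ CE * L ^ (-(d : ℝ)) * (Cf * g x) := by gcongr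
      linarith
  · intro x
    have hgx := hg0 x
    positivity
  · have hsum : ∑ x, g x ≤ CS * L ^ (d : ℝ) := by
      have := hS Λ hΛ 0 L hL1.le
      rw [← Finset.sum_coe_sort Λ] at this
      simpa only [hg, algWeight, dist_zero_right] using this
    rw [← Finset.mul_sum]
    calc _ ≤ (CE * Cf + K₀) * L ^ (-(d : ℝ)) * (CS * L ^ (d : ℝ)) := by gcongr
      _ = (CE * Cf + K₀) * CS * (L ^ (-(d : ℝ)) * L ^ (d : ℝ)) := by ring
      _ = (CE * Cf + K₀) * CS := by
        rw [← Real.rpow_add hL0, neg_add_cancel, Real.rpow_zero, mul_one]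
      _ ≤ _ := by linarith

end Front

/-! ### Expectations in Fock space -/

section Expectation

variable {ι : Type}

theorem tsum_occ_eq_tsum_sector [Fintype ι] [DecidableEq ι] (F : Occ ι → ℝ≥0∞) :
    ∑' n, F n = ∑' N : ℕ, ∑ n : Sector ι N, F n.1 := by
  rw [← (Equiv.sigmaFiberEquiv fun n : Occ ι => ∑ x, n x).tsum_eq, ENNReal.tsum_sigma']
  exact tsum_congr fun N => tsum_fintype _ (L := _)

theorem weighted_nonneg [Fintype ι] {w : ι → ℝ} (hw : ∀ x, 0 ≤ w x) (n : Occ ι) :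
    0 ≤ weighted w n :=
  Finset.sum_nonneg fun x _ => mul_nonneg (hw x) (Nat.cast_nonneg _)

/-- The expectation of a weighted number operator, in the sense of quadratic forms. -/
theorem tsum_weighted [Fintype ι] {w : ι → ℝ} (hw : ∀ x, 0 ≤ w x) (ψ : Fock ι) :
    ∑' n : Occ ι, ENNReal.ofReal (weighted w n * ‖ψ n‖ ^ 2) =
      ∑ x, ENNReal.ofReal (w x) * expNumber {x} ψ := by
  simp only [expNumber, Finset.sum_singleton, ← ENNReal.tsum_mul_left]
  rw [← Summable.tsum_finsetSum fun _ _ => ENNReal.summable]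
  refine tsum_congr fun n => ?_
  rw [weighted, Finset.sum_mul, ENNReal.ofReal_sum_of_nonneg fun x _ =>
    mul_nonneg (mul_nonneg (hw x) (Nat.cast_nonneg _)) (by positivity)]
  refine Finset.sum_congr rfl fun x _ => ?_
  rw [← ENNReal.ofReal_mul (hw x), mul_assoc]

theorem sum_expNumber_singleton (X : Finset ι) (ψ : Fock ι) :
    ∑ x ∈ X, expNumber {x} ψ = expNumber X ψ := by
  simp only [expNumber, Finset.sum_singleton]
  rw [← Summable.tsum_finsetSum fun _ _ => ENNReal.summable]
  refine tsum_congr fun n => ?_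
  rw [Finset.sum_mul, ENNReal.ofReal_sum_of_nonneg fun x _ => by positivity]

/-- Monotonicity of a weighted number operator, summed over the sectors. The bound is linear in the
initial densities, and so it may be summed without any integrability in the number of particles. -/
theorem expNumber_evolve_le [Fintype ι] [DecidableEq ι] {J : Matrix ι ι ℂ}
    (hJ : J.IsHermitian) (Φ : Occ ι → ℝ) {w w' : ℝ → ι → ℝ} {T b : ℝ} (hT : 0 ≤ T) (hb : 0 ≤ b)
    {X : Finset ι}
    (hw : ∀ t x, HasDerivAt (fun t => w t x) (w' t x) t)
    (hcur : ∀ t ∈ Set.Icc 0 T, ∀ u : ι → ℝ, (∀ x, 0 ≤ u x) →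
      ∑ x, w' t x * u x +
        ∑ x, ∑ y, |w t x - w t y| * ‖J x y‖ * (Real.sqrt (u x) * Real.sqrt (u y)) ≤ 0)
    (hpos : ∀ x, 0 ≤ w T x) (hX : ∀ x ∈ X, 1 ≤ b * w T x) {W : ι → ℝ} (hW : ∀ x, 0 ≤ W x)
    (h0 : ∀ x, w 0 x ≤ W x) (ψ : Fock ι) :
    expNumber X (evolve hJ Φ T ψ) ≤
      ENNReal.ofReal b * ∑ x, ENNReal.ofReal (W x) * expNumber {x} ψ := by
  have h1 : ∀ n : Occ ι, ENNReal.ofReal ((∑ x ∈ X, (n x : ℝ)) * ‖evolve hJ Φ T ψ n‖ ^ 2) ≤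
      ENNReal.ofReal b *
        ENNReal.ofReal (weighted (w T) n * ‖evolve hJ Φ T ψ n‖ ^ 2) := fun n => by
    rw [← ENNReal.ofReal_mul hb, ← mul_assoc]
    refine ENNReal.ofReal_le_ofReal (mul_le_mul_of_nonneg_right ?_ (by positivity))
    rw [weighted, Finset.mul_sum]
    refine le_trans (Finset.sum_le_sum fun x hx => ?_)
      (Finset.sum_le_sum_of_subset_of_nonneg (Finset.subset_univ X) fun x _ _ =>
        mul_nonneg hb (mul_nonneg (hpos x) (Nat.cast_nonneg _)))
    rw [← mul_assoc]
    exact le_mul_of_one_le_left (Nat.cast_nonneg _) (hX x hx)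
  refine (ENNReal.tsum_le_tsum h1).trans ?_
  rw [ENNReal.tsum_mul_left, ← tsum_weighted hW]
  refine mul_le_mul_right ?_ _
  rw [tsum_occ_eq_tsum_sector, tsum_occ_eq_tsum_sector]
  refine ENNReal.tsum_le_tsum fun N => ?_
  rw [← ENNReal.ofReal_sum_of_nonneg fun n _ => mul_nonneg (weighted_nonneg hpos _) (by positivity),
    ← ENNReal.ofReal_sum_of_nonneg fun n _ => mul_nonneg (weighted_nonneg hW _) (by positivity)]
  refine ENNReal.ofReal_le_ofReal ?_
  have h2 := sum_weighted_sectorEvolve_le hJ Φ (N := N) (fun m => ψ m.1) hT hw hcur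
  simp only [← evolveAmp_eq_sectorEvolve] at h2
  refine h2.trans (Finset.sum_le_sum fun n _ => ?_)
  unfold weighted
  gcongr with x
  exact h0 x

end Expectation

end BoseGas

theorem theorem4p1 (d : ℕ) (hd : 1 ≤ d) (α CJ : ℝ) (hα : 2 * (d : ℝ) + 1 < α) (hCJ : 0 < CJ)
    (κ v δ₀ : ℝ) (hv : κ < v) (hδ₀ : 0 < δ₀) :
    ∃ C : ℝ, 0 < C ∧
      ∀ Λ : Finset (BoseGas.Space d), BoseGas.Separated Λ →
      ∀ (J : Matrix Λ Λ ℂ) (hJ : J.IsHermitian), BoseGas.PowerLawDecay J CJ α →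
        BoseGas.firstMoment J ≤ κ →
      ∀ (Φ : BoseGas.Occ Λ → ℝ) (l R r : ℝ), 0 < l → 0 < R → 0 < r → max (δ₀ * r) 1 < R - r →
      ∀ ψ₀ : BoseGas.Fock Λ, ψ₀ ∈ BoseGas.sqrtNumberDomain Λ → BoseGas.UniformDensityBound l ψ₀ →
        (⨆ t ∈ Set.Ico (0 : ℝ) ((R - r) / v),
            BoseGas.expNumber (BoseGas.ball Λ r) (BoseGas.evolve hJ Φ t ψ₀)) ≤
          ENNReal.ofReal (1 + C * (R - r)⁻¹) * BoseGas.expNumber (BoseGas.ball Λ R) ψ₀ +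
            ENNReal.ofReal (C * l) := by
  open BoseGas in
  rcases lt_or_ge κ 0 with hκ | hκ
  · -- The first moment is nonnegative, so no hopping matrix qualifies.
    exact ⟨1, one_pos, fun Λ _ J _ _ hJκ => absurd (firstMoment_nonneg.trans hJκ) (not_le.2 hκ)⟩
  obtain ⟨C, hC, hfront⟩ := exists_front_weight d hd hα hCJ hκ hv hδ₀
  refine ⟨C + (1 + C) * C, by positivity, ?_⟩
  intro Λ hΛ J hJ hJα hJκ Φ l R r hl _ hr hRr ψ₀ _ hψ₀
  refine iSup₂_le fun T hT => ?_
  obtain ⟨w, w', D, hw, hcur, hpos, hX, h0, hD, hDC⟩ :=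
    hfront Λ hΛ J hJ hJα hJκ R r T hr hRr hT.1 hT.2.le
  have hL1 : 1 < R - r := (le_max_right _ _).trans_lt hRr
  set b : ℝ := 1 + C * (R - r)⁻¹ with hb
  have hinv : 0 < (R - r)⁻¹ := inv_pos.2 (by linarith)
  have hb0 : 0 ≤ b := by positivity
  have hbC : b ≤ 1 + C := by
    have : (R - r)⁻¹ ≤ 1 := inv_le_one_of_one_le₀ hL1.le
    rw [hb]
    gcongr
    exact mul_le_of_le_one_right hC.le this
  have hite : ∀ x, (0 : ℝ) ≤ if x ∈ ball Λ R then 1 else 0 := fun x => by split_ifs <;> norm_num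
  refine (expNumber_evolve_le hJ Φ hT.1 hb0 hw hcur hpos hX
    (fun x => add_nonneg (hite x) (hD x)) h0 ψ₀).trans ?_
  have hsplit : ∑ x, ENNReal.ofReal ((if x ∈ ball Λ R then 1 else 0) + D x) * expNumber {x} ψ₀ =
      expNumber (ball Λ R) ψ₀ + ∑ x, ENNReal.ofReal (D x) * expNumber {x} ψ₀ := by
    rw [← sum_expNumber_singleton (ball Λ R)]
    simp_rw [ENNReal.ofReal_add (hite _) (hD _), add_mul]
    rw [Finset.sum_add_distrib]
    congr 1
    simp only [apply_ite ENNReal.ofReal, ENNReal.ofReal_one, ENNReal.ofReal_zero, ite_mul, one_mul,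
      zero_mul, Finset.sum_ite_mem, Finset.univ_inter]
  have hDl : ∑ x, ENNReal.ofReal (D x) * expNumber {x} ψ₀ ≤ ENNReal.ofReal (C * l) := by
    calc _ ≤ ∑ x, ENNReal.ofReal (D x) * ENNReal.ofReal l := by
          gcongr with x
          simpa using hψ₀ {x}
      _ = ENNReal.ofReal ((∑ x, D x) * l) := by
          rw [← Finset.sum_mul, ENNReal.ofReal_mul (Finset.sum_nonneg fun x _ => hD x),
            ENNReal.ofReal_sum_of_nonneg fun x _ => hD x]
      _ ≤ _ := by gcongr
  rw [hsplit, mul_add]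
  have hCC : C ≤ C + (1 + C) * C := by nlinarith
  gcongr
  · rw [hb]
    gcongr
  · calc ENNReal.ofReal b * ∑ x, ENNReal.ofReal (D x) * expNumber {x} ψ₀
        ≤ ENNReal.ofReal (1 + C) * ENNReal.ofReal (C * l) := by gcongr
      _ = ENNReal.ofReal ((1 + C) * C * l) := by
          rw [← ENNReal.ofReal_mul (by positivity), mul_assoc]
      _ ≤ _ := by
          gcongr
          linarith
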